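/- A *(row-finite) weighted graph* $(E,\omega)$ consists of countable sets $E^0$ (vertices) and $E^{\mathrm{st}}$ (structured edges), maps $s,r:E^{\mathrm{st}}\to E^0$ such that $s^{-1}(v)$ is finite for every $v\in E^0$, and a weight map $\omega:E^{\mathrm{st}}\to\{1,2,3,\dots\}$. Its edges are distinct symbols $\alpha_i$ ($\alpha\in E^{\mathrm{st}}$, $1\le i\le\omega(\alpha)$); $\alpha_i$ goes from $s(\alpha)$ to $r(\alpha)$, and the ghost edge $\alpha_i^*$ goes from $r(\alpha)$ to $s(\alpha)$. For a vertex $v$ with $s^{-1}(v)\neq\emptyset$ put $\omega(v)=\max\{\omega(\alpha)\mid \alpha\in s^{-1}(v)\}$. $(E,\omega)$ is an *LV-graph* if $\omega(\alpha)\ge 2$ for all $\alpha\in E^{\mathrm{st}}$; $|\{\alpha\in s^{-1}(v)\mid\omega(\alpha)=\omega(v)\}|\ge 2$ for every $v\in E^0$ with $s^{-1}(v)\ne\emptyset$; $E^{\mathrm{st}}\neq\emptyset$; and $(E,\omega)$ is connected, i.e. any two vertices $u,v$ are joined by a generalised path (a trivial path if $u=v$, or a finite composable sequence of edges and ghost edges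 from $u$ to $v$). For a unital, not necessarily commutative ring $R$, the *weighted Leavitt path algebra* $L_R(E,\omega)$ is the quotient of the free (non-unital) $R$-ring on the symbols $v$ ($v\in E^0$), $\alpha_i$, $\alpha_i^*$ ($\alpha\in E^{\mathrm{st}}$, $1\le i\le\omega(\alpha)$), i.e. the free left $R$-module on the nonempty words in these symbols, in which coefficients commute with words, by the two-sided ideal and $R$-subbimodule generated by the relations 1. $vw=\delta_{vw}v$ for $v,w\in E^0$; 2. $s(\alpha)\alpha_i=\alpha_i r(\alpha)=\alpha_i$ and $r(\alpha)\alpha_i^*=\alpha_i^*s(\alpha)=\alpha_i^*$ for $\alpha\in E^{\mathrm{st}}$, $1\le i\le\omega(\alpha)$; 3. $\sum_{\alpha\in s^{-1}(v)}\alpha_i\alpha_j^*=\delta_{ij}v$ for every $v\in E^0$ with $s^{-1}(v)\neq\emptyset$ and $1\le i,j\le\omega(v)$; 4. $\sum_{1\le i\le\max\{\omega(\alpha),\omega(\beta)\}}\alpha_i^*\beta_i=\delta_{\alpha\beta}r(\alpha)$ for $\alpha,\beta\in E^{\mathrm{st}}$, where in (3) and (4) $\alpha_i$ and $\alpha_i^*$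 are read as zero whenever $i>\omega(\alpha)$. **Theorem.** Let $(E,\omega)$ be an LV-graph and let $R$ be a domain (a nonzero unital ring without zero divisors, not necessarily commutative). Then $L_R(E,\omega)$ is a prime ring: it is nonzero, and for all nonzero $a,b\in L_R(E,\omega)$ there is an $x\in L_R(E,\omega)$ with $axb\neq 0$. -/

import Mathlib

universe u v w

/-- A row-finite weighted graph with vertex set `V` and set of structured edges `S`. -/
structure WeightedGraph (V : Type u) (S : Type v) where
  /-- source -/
  src : S → V
  /-- range -/
  rng : S → V
  /-- weight map, with values in the positive integers -/
  weight : S → ℕ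
  weight_pos : ∀ α, 1 ≤ weight α
  rowFinite : ∀ v : V, {α : S | src α = v}.Finite

namespace WeightedGraph

variable {V : Type u} {S : Type v}

/-- The finite set of structured edges emitted by `v`. -/
noncomputable def emitted (E : WeightedGraph V S) (v : V) : Finset S :=
  (E.rowFinite v).toFinset

/-- The maximal weight of a structured edge emitted by `v` (zero if `v` is a sink). -/
noncomputable def vertexWeight (E : WeightedGraph V S) (v : V) : ℕ :=
  (E.emitted v).sup E.weight

/-- A vertex is a sink if it emits no structured edge. -/
def IsSink (E : WeightedGraph V S) (v : V) : Prop :=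
  ∀ α : S, E.src α ≠ v

/-- `E.GenReach u v`: there is a generalised path from `u` to `v`, i.e. a trivial path (`u = v`) or
a word in the edges and ghost edges whose consecutive letters are composable. A ghost edge
`α_i^*` goes from the range of `α` to its source. -/
inductive GenReach (E : WeightedGraph V S) : V → V → Prop
  | trivial (v : V) : GenReach E v v
  | edge {u : V} (α : S) (i : Fin (E.weight α)) :
      GenReach E u (E.src α) → GenReach E u (E.rng α)
  | ghost {u : V} (α : S) (i : Fin (E.weight α)) :
      GenReach E u (E.rng α) → GenReach E u (E.src α)

/-- There is exactly one connected component. -/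
def Connected (E : WeightedGraph V S) : Prop :=
  Nonempty V ∧ ∀ u v : V, E.GenReach u v

/-- LV-graphs: every structured edge has weight at least two, every vertex that is not a sink
emits at least two structured edges of maximal weight, there is at least one structured edge,
and the graph is connected. -/
structure IsLVGraph (E : WeightedGraph V S) : Prop where
  two_le_weight : ∀ α : S, 2 ≤ E.weight α
  two_le_max : ∀ v : V, ¬ E.IsSink v →
    2 ≤ Set.encard {α : S | E.src α = v ∧ E.weight α = E.vertexWeight v}
  nonempty_edges : Nonempty S
  connected : E.Connected

/-- The generators: vertices, edges `α_i` and ghost edges `α_i^*`. The index `i` of an edge runs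
through `0, …, ω(α) - 1` instead of `1, …, ω(α)`. -/
inductive Generator (E : WeightedGraph V S) : Type (max u v)
  | vertex (v : V) : Generator E
  | edge (α : S) (i : Fin (E.weight α)) : Generator E
  | ghost (α : S) (i : Fin (E.weight α)) : Generator E

/-- The free (non-unital) `R`-ring on the generators: formal left linear combinations of nonempty
words, where coefficients commute with words. -/
abbrev FreeRRing (R : Type w) [Ring R] (E : WeightedGraph V S) : Type (max u v w) :=
  MonoidAlgebra R (FreeSemigroup E.Generator)

section Generators

variable (R : Type w) [Ring R] (E : WeightedGraph V S)

/-- A generator as an element of the free `R`-ring. -/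
noncomputable def gen (x : E.Generator) : FreeRRing R E :=
  MonoidAlgebra.single (FreeSemigroup.of x) 1

/-- The vertex `v` in the free `R`-ring. -/
noncomputable def vtx (v : V) : FreeRRing R E :=
  gen R E (.vertex v)

/-- The edge with index `i` of `α`, with the convention that it is zero if `i` is out of range. -/
noncomputable def edg (α : S) (i : ℕ) : FreeRRing R E :=
  if h : i < E.weight α then gen R E (.edge α ⟨i, h⟩) else 0

/-- The ghost edge with index `i` of `α`, with the same convention. -/
noncomputable def gho (α : S) (i : ℕ) : FreeRRing R E :=
  if h : i < E.weight α then gen R E (.ghost α ⟨i, h⟩) else 0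

open Classical in
/-- The defining relations `lhs = rhs` of the weighted Leavitt path algebra. -/
inductive LeavittRel : FreeRRing R E → FreeRRing R E → Prop
  | vertex_mul (v w : V) :
      LeavittRel (vtx R E v * vtx R E w) (if v = w then vtx R E v else 0)
  | src_mul_edge (α : S) (i : ℕ) (hi : i < E.weight α) :
      LeavittRel (vtx R E (E.src α) * edg R E α i) (edg R E α i)
  | edge_mul_rng (α : S) (i : ℕ) (hi : i < E.weight α) :
      LeavittRel (edg R E α i * vtx R E (E.rng α)) (edg R E α i)
  | rng_mul_ghost (α : S) (i : ℕ) (hi : i < E.weight α) :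
      LeavittRel (vtx R E (E.rng α) * gho R E α i) (gho R E α i)
  | ghost_mul_src (α : S) (i : ℕ) (hi : i < E.weight α) :
      LeavittRel (gho R E α i * vtx R E (E.src α)) (gho R E α i)
  | sum_edge_ghost (v : V) (i j : ℕ) (hi : i < E.vertexWeight v) (hj : j < E.vertexWeight v) :
      LeavittRel (∑ α ∈ E.emitted v, edg R E α i * gho R E α j) (if i = j then vtx R E v else 0)
  | sum_ghost_edge (α β : S) :
      LeavittRel (∑ i ∈ Finset.range (max (E.weight α) (E.weight β)), gho R E α i * edg R E β i)
        (if α = β then vtx R E (E.rng α) else 0)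

/-- The ideal of the free `R`-ring generated by the defining relations: the smallest two-sided
ideal that is an `R`-subbimodule and contains `lhs - rhs` for each relation. -/
noncomputable def leavittIdeal : TwoSidedIdeal (FreeRRing R E) :=
  sInf {J | (∀ (r : R), ∀ x ∈ J, r • x ∈ J) ∧ (∀ (r : R), ∀ x ∈ J, MulOpposite.op r • x ∈ J) ∧
    ∀ a b, LeavittRel R E a b → a - b ∈ J}

/-- The weighted Leavitt path algebra of `E` with coefficients in `R`. -/
def LeavittPathAlgebra : Type (max u v w) :=
  (leavittIdeal R E).ringCon.Quotient

noncomputable instance : NonUnitalRing (LeavittPathAlgebra R E) :=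
  inferInstanceAs (NonUnitalRing (leavittIdeal R E).ringCon.Quotient)

end Generators

end WeightedGraph

/-- A (not necessarily unital) ring `A` is prime if it is nonzero and `a A b = 0` implies `a = 0`
or `b = 0`. -/
def IsPrimeRing (A : Type u) [NonUnitalRing A] : Prop :=
  Nontrivial A ∧ ∀ a b : A, (∀ x : A, a * x * b = 0) → a = 0 ∨ b = 0

/-! At every vertex that emits edges, fix a special edge of maximal weight and a second one. Solving
the defining sum relations for the words `α_i α_j^*` with `α` special, and `α_0^* β_0` with `α`, `β`
of equal source, gives rewriting rules; normal paths are those that avoid these words. Letters act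
on combinations of normal paths by prepending and rewriting once. One step suffices, because the
replacing pairs keep the neighbouring letters compatible. The only delicate point is that the
relations hold on overlaps of the two rules (`sum_edge_ghost_single`, `sum_ghost_edge_single`). The
resulting action of the algebra is faithful (`exists_rep_ne_zero`): modulo the relations, `x v` is
recovered from the action of `x` on the trivial path at `v` (`toLPA_mul_embed`).

The heart is `rep_embed_ne_zero`: nonzero combinations of normal paths ending, respectively
starting, in one vertex have nonzero product. Take longest words `l x₀` and `y₀ k` in the two
factors. In words of maximal length, rewriting changes only the two letters at the junction. Hence,
if the product were zero, the coefficients `f x` of `l x` and `g y` of `y k` would satisfy `f x * g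
y = f x' * g y'` when the forbidden `x' y'` rewrites to `x y`, and `f x * g y = 0` when `x y` is
normal and arises from no such pair. The second maximal edge, or the index 1, supplies enough such
words to contradict `f x₀ * g y₀ ≠ 0`.

For primeness, choose a trivial path not killed by `a`, and a nonzero component of the image under
`b` of another one. A generalised path joins the vertices involved, and nonvanishing of products
carries through each letter of it and through the final product. -/

namespace WeightedGraph

variable {V : Type u} {S : Type v}

/-! ### Letters, special edges and normal paths -/

/-- The letters of generalised paths: `edge α i` stands for `α_i`, `ghost α i` for `α_i^*`. -/
inductive Letter (S : Type v) : Type v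
  | edge (α : S) (i : ℕ) : Letter S
  | ghost (α : S) (i : ℕ) : Letter S

namespace Letter

/-- The vertex at which a letter starts. -/
def start (E : WeightedGraph V S) : Letter S → V
  | edge α _ => E.src α
  | ghost α _ => E.rng α

/-- The vertex at which a letter ends. -/
def finish (E : WeightedGraph V S) : Letter S → V
  | edge α _ => E.rng α
  | ghost α _ => E.src α

/-- A letter is valid if its index is smaller than the weight of its structured edge. -/
def Valid (E : WeightedGraph V S) : Letter S → Prop
  | edge α i => i < E.weight α
  | ghost α i => i < E.weight α

end Letter

/-- A choice of two distinct structured edges of maximal weight at each vertex that is not a sink,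
in a graph all of whose weights are at least two. -/
structure SpecialEdges (E : WeightedGraph V S) where
  /-- the special edge, which is used to define normal paths -/
  special : V → S
  /-- another edge of maximal weight -/
  other : V → S
  src_special : ∀ α, E.src (special (E.src α)) = E.src α
  weight_le_special : ∀ α, E.weight α ≤ E.weight (special (E.src α))
  src_other : ∀ α, E.src (other (E.src α)) = E.src α
  weight_le_other : ∀ α, E.weight α ≤ E.weight (other (E.src α))
  other_ne : ∀ α, other (E.src α) ≠ special (E.src α)
  two_le_weight : ∀ α, 2 ≤ E.weight α

/-- The vertex at which the path with letters `l` and end `v` starts. -/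
def pathStart (E : WeightedGraph V S) : List (Letter S) → V → V
  | [], v => v
  | x :: _, _ => x.start E

/-- The free left `R`-module on pairs of a word and a vertex. -/
abbrev PathModule (R : Type w) [Ring R] (V : Type u) (S : Type v) : Type (max u v w) :=
  (List (Letter S) × V) →₀ R

variable {E : WeightedGraph V S}

lemma mem_emitted {α : S} {v : V} : α ∈ E.emitted v ↔ E.src α = v := by
  simp [emitted]

namespace SpecialEdges

variable (D : SpecialEdges E)

/-- The pairs of letters that do not occur in normal paths. -/
def Forbidden : Letter S → Letter S → Prop
  | .edge α _, .ghost β _ => α = β ∧ α = D.special (E.src α)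
  | .ghost α i, .edge β j => i = 0 ∧ j = 0 ∧ E.src α = E.src β
  | _, _ => False

/-- The word `l` is a normal generalised path that ends in `v`. -/
def Normal : List (Letter S) → V → Prop
  | [], _ => True
  | x :: l, v => x.Valid E ∧ x.finish E = pathStart E l v ∧
      (∀ y ∈ l.head?, ¬ D.Forbidden x y) ∧ Normal l v

lemma Forbidden.finish_eq {x y : Letter S} (h : D.Forbidden x y) : x.finish E = y.start E := by
  cases x <;> cases y <;> simp_all [Forbidden, Letter.finish, Letter.start]

lemma Forbidden.cases {x y : Letter S} (h : D.Forbidden x y) :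
    (∃ α i j, α = D.special (E.src α) ∧ x = .edge α i ∧ y = .ghost α j) ∨
    (∃ α β, E.src α = E.src β ∧ x = .ghost α 0 ∧ y = .edge β 0) := by
  cases x <;> cases y <;> simp only [Forbidden] at h
  · obtain ⟨rfl, h⟩ := h
    exact .inl ⟨_, _, _, h, rfl, rfl⟩
  · obtain ⟨rfl, rfl, h⟩ := h
    exact .inr ⟨_, _, h, rfl, rfl⟩

lemma forbidden_edge_ghost {α : S} (h : α = D.special (E.src α)) (i j : ℕ) :
    D.Forbidden (.edge α i) (.ghost α j) := ⟨rfl, h⟩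

lemma forbidden_ghost_edge {α β : S} (h : E.src α = E.src β) :
    D.Forbidden (.ghost α 0) (.edge β 0) := ⟨rfl, rfl, h⟩

lemma Normal.tail {x : Letter S} {l : List (Letter S)} {v : V} (h : D.Normal (x :: l) v) :
    D.Normal l v := h.2.2.2

/-! ### The rewriting action on the path module -/

section Action

variable (R : Type w) [Ring R]

open Classical in
/-- A path as an element of the path module, if it is normal; zero otherwise. -/
noncomputable def path (l : List (Letter S)) (v : V) : PathModule R V S :=
  if D.Normal l v then Finsupp.single (l, v) 1 else 0

open Classical in
/-- The normal form of the path `x :: y :: l` for a forbidden pair `x`, `y`. -/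
noncomputable def reduct (x y : Letter S) (l : List (Letter S)) (v : V) : PathModule R V S :=
  match x, y with
  | .edge α i, .ghost _ j => (if i = j then D.path R l v else 0) -
      ∑ γ ∈ (E.emitted (E.src α)).erase α, D.path R (.edge γ i :: .ghost γ j :: l) v
  | .ghost α _, .edge β _ => (if α = β then D.path R l v else 0) -
      -- Indices out of range for `β` need no separate treatment: `path` sends those words to zero.
      ∑ k ∈ Finset.Ico 1 (E.weight α), D.path R (.ghost α k :: .edge β k :: l) v
  | _, _ => 0

open Classical in
/-- The action of a letter on a path. -/
noncomputable def act (x : Letter S) (l : List (Letter S)) (v : V) : PathModule R V S :=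
  if D.Normal l v then
    match l with
    | [] => D.path R [x] v
    | y :: l => if D.Forbidden x y then D.reduct R x y l v else D.path R (x :: y :: l) v
  else 0

open Classical in
/-- The linear endomorphism of the path module given by a letter. -/
noncomputable def letterMap (x : Letter S) : PathModule R V S →ₗ[R] PathModule R V S :=
  Finsupp.linearCombination R fun p => D.act R x p.1 p.2

open Classical in
/-- The linear endomorphism of the path module given by a vertex. -/
noncomputable def vertexMap (u : V) : PathModule R V S →ₗ[R] PathModule R V S :=
  Finsupp.linearCombination R fun p => if pathStart E p.1 p.2 = u then D.path R p.1 p.2 else 0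

variable {R}

lemma path_of_normal {l : List (Letter S)} {v : V} (h : D.Normal l v) :
    D.path R l v = Finsupp.single (l, v) 1 := if_pos h

lemma path_of_not_normal {l : List (Letter S)} {v : V} (h : ¬ D.Normal l v) :
    D.path R l v = 0 := if_neg h

lemma path_cons_of_not_valid {x : Letter S} {l : List (Letter S)} {v : V} (h : ¬ x.Valid E) :
    D.path R (x :: l) v = 0 := D.path_of_not_normal fun hn => h hn.1

lemma path_cons_of_finish_ne {x : Letter S} {l : List (Letter S)} {v : V}
    (h : x.finish E ≠ pathStart E l v) : D.path R (x :: l) v = 0 :=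
  D.path_of_not_normal fun hn => h hn.2.1

lemma act_of_not_normal {x : Letter S} {l : List (Letter S)} {v : V} (h : ¬ D.Normal l v) :
    D.act R x l v = 0 := if_neg h

lemma act_of_not_forbidden {x : Letter S} {l : List (Letter S)} {v : V}
    (hx : ∀ y ∈ l.head?, ¬ D.Forbidden x y) : D.act R x l v = D.path R (x :: l) v := by
  by_cases h : D.Normal l v
  · cases l with
    | nil => exact if_pos h
    | cons y l => exact (if_pos h).trans (if_neg (hx y (by simp)))
  · rw [D.act_of_not_normal h, path_of_not_normal]
    exact fun hn => h hn.tail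

lemma act_of_forbidden {x y : Letter S} {l : List (Letter S)} {v : V}
    (h : D.Normal (y :: l) v) (hx : D.Forbidden x y) :
    D.act R x (y :: l) v = D.reduct R x y l v := by
  exact (if_pos h).trans (if_pos hx)

lemma act_of_finish_ne {x : Letter S} {l : List (Letter S)} {v : V}
    (h : x.finish E ≠ pathStart E l v) : D.act R x l v = 0 := by
  rw [act_of_not_forbidden, D.path_cons_of_finish_ne h]
  intro y hy hf
  cases l with
  | nil => simp at hy
  | cons z l =>
    simp only [List.head?_cons, Option.mem_def, Option.some.injEq] at hy
    subst hy
    exact h hf.finish_eq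

@[simp]
lemma letterMap_single (x : Letter S) (l : List (Letter S)) (v : V) (r : R) :
    D.letterMap R x (Finsupp.single (l, v) r) = r • D.act R x l v := by
  simp [letterMap]

@[simp]
lemma vertexMap_single (u : V) (l : List (Letter S)) (v : V) (r : R) [Decidable (pathStart E l v = u)] :
    D.vertexMap R u (Finsupp.single (l, v) r) =
      r • if pathStart E l v = u then D.path R l v else 0 := by
  simp only [vertexMap, Finsupp.linearCombination_single]

lemma letterMap_path (x : Letter S) (l : List (Letter S)) (v : V) :
    D.letterMap R x (D.path R l v) = D.act R x l v := by
  by_cases h : D.Normal l v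
  · simp [D.path_of_normal h]
  · simp [D.path_of_not_normal h, D.act_of_not_normal h]

lemma vertexMap_path (u : V) (l : List (Letter S)) (v : V) [Decidable (pathStart E l v = u)] :
    D.vertexMap R u (D.path R l v) = if pathStart E l v = u then D.path R l v else 0 := by
  by_cases h : D.Normal l v
  · simp [D.path_of_normal h]
  · simp [D.path_of_not_normal h]

lemma letterMap_path_of_not_forbidden {x : Letter S} {l : List (Letter S)} {v : V}
    (hx : ∀ y ∈ l.head?, ¬ D.Forbidden x y) :
    D.letterMap R x (D.path R l v) = D.path R (x :: l) v := by
  rw [letterMap_path, D.act_of_not_forbidden hx]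

/-- To show that two linear maps agree it is enough to look at all paths. -/
lemma linearMap_ext {M : Type*} [AddCommMonoid M] [Module R M] {f g : PathModule R V S →ₗ[R] M}
    (h : ∀ l v, f (Finsupp.single (l, v) 1) = g (Finsupp.single (l, v) 1)) : f = g := by
  ext ⟨l, v⟩
  exact h l v

/-- A forbidden pair is rewritten to pairs with the same start. The shortened path occurs only when
the pair is a loop, so it starts there as well. -/
lemma vertexMap_start_act (x : Letter S) (l : List (Letter S)) (v : V) :
    D.vertexMap R (x.start E) (D.act R x l v) = D.act R x l v := by
  classical
  by_cases h : ∃ y ∈ l.head?, D.Forbidden x y ∧ D.Normal l v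
  · obtain ⟨y, hy, hf, hn⟩ := h
    cases l with
    | nil => simp at hy
    | cons z l =>
      simp only [List.head?_cons, Option.mem_def, Option.some.injEq] at hy
      subst hy
      rw [D.act_of_forbidden hn hf]
      obtain ⟨α, i, j, hα, rfl, rfl⟩ | ⟨α, β, hα, rfl, rfl⟩ := hf.cases
      · simp only [reduct, map_sub, map_sum, apply_ite (D.vertexMap R _), vertexMap_path, map_zero]
        have h1 := hn.2.1
        simp only [Letter.finish] at h1
        congr 1
        · simp [← h1, Letter.start]
        · refine Finset.sum_congr rfl fun γ hγ => if_pos ?_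
          simpa [pathStart, Letter.start] using mem_emitted.1 (Finset.mem_of_mem_erase hγ)
      · simp only [reduct, map_sub, map_sum, apply_ite (D.vertexMap R _), vertexMap_path, map_zero]
        have h1 := hn.2.1
        simp only [Letter.finish] at h1
        congr 1
        · simp only [← h1, Letter.start]
          split_ifs with h2 h3
          · rfl
          · exact absurd (by rw [h2]) h3
          · rfl
        · exact Finset.sum_congr rfl fun γ hγ => if_pos rfl
  · by_cases hn : D.Normal l v
    · rw [act_of_not_forbidden, vertexMap_path]
      · exact if_pos rfl
      exact fun y hy hf => h ⟨y, hy, hf, hn⟩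
    · simp [D.act_of_not_normal hn]

/-- The relations `s(α) α_i = α_i` and `r(α) α_i^* = α_i^*`. -/
lemma vertexMap_start_letterMap (x : Letter S) (n : PathModule R V S) :
    D.vertexMap R (x.start E) (D.letterMap R x n) = D.letterMap R x n := by
  refine LinearMap.congr_fun (f := D.vertexMap R (x.start E) ∘ₗ D.letterMap R x) ?_ n
  refine linearMap_ext fun l v => ?_
  simp [vertexMap_start_act]

lemma letterMap_vertexMap (x : Letter S) (u : V) (n : PathModule R V S) [Decidable (x.finish E = u)] :
    D.letterMap R x (D.vertexMap R u n) = if x.finish E = u then D.letterMap R x n else 0 := by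
  classical
  induction n using Finsupp.induction_linear with
  | zero => simp
  | add f g hf hg =>
    rw [map_add, map_add, hf, hg, map_add]
    split_ifs <;> simp
  | single p r =>
    obtain ⟨l, v⟩ := p
    simp only [vertexMap_single, letterMap_single, map_smul, apply_ite (D.letterMap R _),
      letterMap_path, map_zero]
    by_cases h : x.finish E = u
    · rw [if_pos h]
      split_ifs with h1
      · rfl
      · rw [D.act_of_finish_ne (by rw [h]; exact Ne.symm h1)]
    · rw [if_neg h]
      split_ifs with h1
      · rw [D.act_of_finish_ne (by rw [h1]; exact h), smul_zero]
      · simp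

/-- The relations `α_i r(α) = α_i` and `α_i^* s(α) = α_i^*`. -/
lemma letterMap_vertexMap_finish (x : Letter S) (n : PathModule R V S) :
    D.letterMap R x (D.vertexMap R (x.finish E) n) = D.letterMap R x n := by
  classical
  rw [letterMap_vertexMap, if_pos rfl]

/-- The relation `u v = δ_{uv} u`. -/
lemma vertexMap_vertexMap (u u' : V) (n : PathModule R V S) [Decidable (u = u')] :
    D.vertexMap R u (D.vertexMap R u' n) = if u = u' then D.vertexMap R u n else 0 := by
  classical
  induction n using Finsupp.induction_linear with
  | zero => simp
  | add f g hf hg =>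
    rw [map_add, map_add, hf, hg, map_add]
    split_ifs <;> simp
  | single p r =>
    obtain ⟨l, v⟩ := p
    simp only [vertexMap_single, map_smul, apply_ite (D.vertexMap R _), vertexMap_path, map_zero]
    split_ifs <;> simp_all

/-- Out-of-range letters thus act as the zero that the relations prescribe, so that index ranges can
be padded freely. This uses that the special edge has maximal weight: an index too large for it is
too large for every edge in the sum that replaces it. -/
lemma letterMap_of_not_valid {x : Letter S} (hx : ¬ x.Valid E) : D.letterMap R x = 0 := by
  classical
  refine linearMap_ext fun l v => ?_
  simp only [letterMap_single, one_smul, LinearMap.zero_apply]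
  by_cases h : ∃ y ∈ l.head?, D.Forbidden x y ∧ D.Normal l v
  · obtain ⟨y, hy, hf, hn⟩ := h
    cases l with
    | nil => simp at hy
    | cons z l =>
      simp only [List.head?_cons, Option.mem_def, Option.some.injEq] at hy
      subst hy
      rw [D.act_of_forbidden hn hf]
      obtain ⟨α, i, j, hα, rfl, rfl⟩ | ⟨α, β, hα, rfl, rfl⟩ := hf.cases
      · have h1 := hn.1
        simp only [Letter.Valid] at h1 hx
        rw [reduct, if_neg (by omega), zero_sub, neg_eq_zero]
        refine Finset.sum_eq_zero fun γ hγ => D.path_cons_of_not_valid ?_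
        have h2 := D.weight_le_special γ
        rw [mem_emitted.1 (Finset.mem_of_mem_erase hγ), ← hα] at h2
        simp only [Letter.Valid]
        omega
      -- The letter is `α_0^*`, and index 0 is never out of range.
      · have := D.two_le_weight α
        simp only [Letter.Valid] at hx
        omega
  · by_cases hn : D.Normal l v
    · rw [act_of_not_forbidden, D.path_cons_of_not_valid hx]
      exact fun y hy hf => h ⟨y, hy, hf, hn⟩
    · simp [D.act_of_not_normal hn]

end Action

/-! ### The sum relations hold on the path module -/

section Relations

variable {R : Type w} [Ring R]

lemma special_eq {α β : S} (h : E.src α = E.src β) (hα : α = D.special (E.src α))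
    (hβ : β = D.special (E.src β)) : α = β := by rw [hα, hβ, h]

-- The tail is not assumed normal: otherwise both sides vanish, which spares later sums a case
-- distinction.
open Classical in
lemma letterMap_edge_path_ghost {α : S} (hα : α = D.special (E.src α)) {i j : ℕ}
    (hj : j < E.weight α) {l : List (Letter S)} {v : V} (hl : E.src α = pathStart E l v)
    (hf : ∀ y ∈ l.head?, ¬ D.Forbidden (.ghost α j) y) :
    D.letterMap R (.edge α i) (D.path R (.ghost α j :: l) v) =
      (if i = j then D.path R l v else 0) -
        ∑ γ ∈ (E.emitted (E.src α)).erase α, D.path R (.edge γ i :: .ghost γ j :: l) v := by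
  by_cases h : D.Normal l v
  · have hn : D.Normal (.ghost α j :: l) v := ⟨hj, hl, hf, h⟩
    rw [letterMap_path, D.act_of_forbidden hn (D.forbidden_edge_ghost hα _ _), reduct]
  · rw [D.path_of_not_normal h, D.path_of_not_normal fun hn => h hn.tail,
      Finset.sum_eq_zero fun γ _ => D.path_of_not_normal fun hn => h hn.tail.tail]
    simp

lemma letterMap_edge_path_ghost_of_ne {α : S} (hα : α ≠ D.special (E.src α)) {i j : ℕ}
    {l : List (Letter S)} {v : V} :
    D.letterMap R (.edge α i) (D.path R (.ghost α j :: l) v) =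
      D.path R (.edge α i :: .ghost α j :: l) v :=
  D.letterMap_path_of_not_forbidden (by simp [Forbidden, hα])

open Classical in
lemma letterMap_ghost_path_edge {α β : S} (hα : E.src α = E.src β)
    {l : List (Letter S)} {v : V} (hl : E.rng β = pathStart E l v)
    (hf : ∀ y ∈ l.head?, ¬ D.Forbidden (.edge β 0) y) :
    D.letterMap R (.ghost α 0) (D.path R (.edge β 0 :: l) v) =
      (if α = β then D.path R l v else 0) -
        ∑ k ∈ Finset.Ico 1 (E.weight α), D.path R (.ghost α k :: .edge β k :: l) v := by
  by_cases h : D.Normal l v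
  · have hn : D.Normal (.edge β 0 :: l) v :=
      ⟨by have := D.two_le_weight β; simp only [Letter.Valid]; omega, hl, hf, h⟩
    rw [letterMap_path, D.act_of_forbidden hn (D.forbidden_ghost_edge hα), reduct]
  · rw [D.path_of_not_normal h, D.path_of_not_normal fun hn => h hn.tail,
      Finset.sum_eq_zero fun γ _ => D.path_of_not_normal fun hn => h hn.tail.tail]
    simp

lemma letterMap_ghost_path_edge_of_ne {α β : S} {i j : ℕ} (hi : ¬ (i = 0 ∧ j = 0))
    {l : List (Letter S)} {v : V} :
    D.letterMap R (.ghost α i) (D.path R (.edge β j :: l) v) =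
      D.path R (.ghost α i :: .edge β j :: l) v :=
  D.letterMap_path_of_not_forbidden (by
    intro y hy hf
    simp only [List.head?_cons, Option.mem_def, Option.some.injEq] at hy
    subst hy
    exact hi ⟨hf.1, hf.2.1⟩)

lemma weight_le_vertexWeight (α : S) : E.weight α ≤ E.vertexWeight (E.src α) :=
  Finset.le_sup (f := E.weight) (mem_emitted.2 rfl)

lemma exists_mem_of_lt_vertexWeight {u : V} {i : ℕ} (hi : i < E.vertexWeight u) :
    ∃ α, E.src α = u ∧ i < E.weight α := by
  rw [vertexWeight, Finset.lt_sup_iff] at hi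
  obtain ⟨α, h1, h2⟩ := hi
  exact ⟨α, mem_emitted.1 h1, h2⟩

/-- The relation (3) on a path which can be prefixed with ghost edges with index `j`. -/
lemma sum_letterMap_edge_path_ghost {u : V} {i j : ℕ} (hj : j < E.vertexWeight u)
    {l : List (Letter S)} {v : V} (hl : u = pathStart E l v)
    (hf : ∀ α, E.src α = u → ∀ y ∈ l.head?, ¬ D.Forbidden (.ghost α j) y) :
    ∑ α ∈ E.emitted u, D.letterMap R (.edge α i) (D.path R (.ghost α j :: l) v) =
      if i = j then D.path R l v else 0 := by
  classical
  obtain ⟨α, hα, hw⟩ := exists_mem_of_lt_vertexWeight hj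
  have hsp : E.src (D.special u) = u := by rw [← hα, D.src_special]
  have hm : D.special u ∈ E.emitted u := mem_emitted.2 hsp
  have hwt : j < E.weight (D.special u) := by
    rw [← hα]
    exact hw.trans_le (D.weight_le_special α)
  rw [← Finset.add_sum_erase _ _ hm, D.letterMap_edge_path_ghost (by rw [hsp]) hwt
    (by rw [hsp, hl]) (hf _ hsp), hsp, sub_add_eq_add_sub, add_sub_assoc, add_eq_left,
    sub_eq_zero]
  refine Finset.sum_congr rfl fun γ hγ => D.letterMap_edge_path_ghost_of_ne ?_
  rw [mem_emitted.1 (Finset.mem_of_mem_erase hγ)]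
  exact Finset.ne_of_mem_erase hγ

/-- The relation (4) on a path which can be prefixed with `β_i`. -/
lemma sum_letterMap_ghost_path_edge {α β : S} (hαβ : E.src α = E.src β) {m : ℕ}
    (hm : E.weight α ≤ m) [Decidable (α = β)]
    {l : List (Letter S)} {v : V} (hl : E.rng β = pathStart E l v)
    (hf : ∀ i, ∀ y ∈ l.head?, ¬ D.Forbidden (.edge β i) y) :
    ∑ i ∈ Finset.range m, D.letterMap R (.ghost α i) (D.path R (.edge β i :: l) v) =
      if α = β then D.path R l v else 0 := by
  have h2 := D.two_le_weight α
  rw [Finset.range_eq_Ico, Finset.sum_eq_sum_Ico_succ_bot (by omega),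
    D.letterMap_ghost_path_edge hαβ hl (hf 0), sub_add_eq_add_sub, add_sub_assoc]
  have : ∑ k ∈ Finset.Ico (0 + 1) m, D.letterMap R (.ghost α k) (D.path R (.edge β k :: l) v) =
      ∑ k ∈ Finset.Ico 1 (E.weight α), D.path R (.ghost α k :: .edge β k :: l) v := by
    symm
    -- The indices from `E.weight α` up to `m` contribute nothing, since there `α_k^*` is not a
    -- valid letter.
    refine Finset.sum_subset_zero_on_sdiff (Finset.Ico_subset_Ico le_rfl hm) ?_ ?_
    · intro k hk
      simp only [Finset.mem_sdiff, Finset.mem_Ico] at hk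
      rw [D.letterMap_of_not_valid (by simp only [Letter.Valid]; omega), LinearMap.zero_apply]
    · intro k hk
      rw [Finset.mem_Ico] at hk
      exact (D.letterMap_ghost_path_edge_of_ne (by omega)).symm
  rw [this, sub_self, add_zero]
  congr

lemma not_forbidden_edge_of_normal {η : S} {i j : ℕ} {l : List (Letter S)} {v : V}
    (h : D.Normal (.edge η i :: l) v) : ∀ y ∈ l.head?, ¬ D.Forbidden (.edge η j) y := by
  intro y hy hf
  refine h.2.2.1 y hy ?_
  cases y <;> exact hf

lemma not_forbidden_ghost_of_normal {η α : S} {j : ℕ} {l : List (Letter S)} {v : V}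
    (h : D.Normal (.ghost η j :: l) v) (hα : E.src α = E.src η) :
    ∀ y ∈ l.head?, ¬ D.Forbidden (.ghost α j) y := by
  intro y hy hf
  refine h.2.2.1 y hy ?_
  cases y
  · exact ⟨hf.1, hf.2.1, hα.symm.trans hf.2.2⟩
  · exact hf

/-- If no ghost edge meets `l` in a forbidden pair, only the first rewriting rule is involved. The
remaining case is the overlap `α_i α_0^* η_0`: the ghost-edge pair is rewritten first, and the terms
with index `k ≥ 1` fall under the previous case. -/
lemma sum_edge_ghost_single {u : V} {i j : ℕ} (hi : i < E.vertexWeight u)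
    (hj : j < E.vertexWeight u) (l : List (Letter S)) (v : V) (hl : u = pathStart E l v) :
    ∑ α ∈ E.emitted u, D.letterMap R (.edge α i) (D.act R (.ghost α j) l v) =
      if i = j then D.path R l v else 0 := by
  classical
  by_cases hn : D.Normal l v
  swap
  · simp [D.act_of_not_normal hn, D.path_of_not_normal hn]
  by_cases h : ∃ η l', E.src η = u ∧ j = 0 ∧ l = .edge η 0 :: l'
  · obtain ⟨η, l', hη, rfl, rfl⟩ := h
    have h1 : ∀ α ∈ E.emitted u, D.letterMap R (.edge α i) (D.act R (.ghost α 0)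
        (.edge η 0 :: l') v) = (if α = η then D.path R (.edge η i :: l') v else 0) -
        ∑ k ∈ Finset.Ico 1 (E.vertexWeight u),
          D.letterMap R (.edge α i) (D.path R (.ghost α k :: .edge η k :: l') v) := by
      intro α hα
      rw [mem_emitted] at hα
      rw [D.act_of_forbidden hn (D.forbidden_ghost_edge (by rw [hα, hη])), reduct, map_sub, map_sum]
      congr 1
      · split_ifs with h
        · subst h
          exact D.letterMap_path_of_not_forbidden (D.not_forbidden_edge_of_normal hn)
        · rw [map_zero]
      -- Padding to a bound independent of `α` adds only zero terms and permits interchanging the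
      -- sums.
      · refine Finset.sum_subset (Finset.Ico_subset_Ico le_rfl ?_) fun k hk hk' => ?_
        · rw [← hα]
          exact weight_le_vertexWeight α
        · rw [Finset.mem_Ico] at hk hk'
          rw [D.path_cons_of_not_valid (by simp only [Letter.Valid]; omega), map_zero]
    rw [Finset.sum_congr rfl h1, Finset.sum_sub_distrib, Finset.sum_ite_eq',
      if_pos (mem_emitted.2 hη), Finset.sum_comm]
    have h2 : ∀ k ∈ Finset.Ico 1 (E.vertexWeight u), ∑ α ∈ E.emitted u,
        D.letterMap R (.edge α i) (D.path R (.ghost α k :: .edge η k :: l') v) =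
        if i = k then D.path R (.edge η k :: l') v else 0 := by
      intro k hk
      rw [Finset.mem_Ico] at hk
      refine D.sum_letterMap_edge_path_ghost hk.2 hη.symm ?_
      rintro α - y hy hf
      simp only [List.head?_cons, Option.mem_def, Option.some.injEq] at hy
      subst hy
      have := hf.1
      omega
    rw [Finset.sum_congr rfl h2, Finset.sum_ite_eq]
    -- For `i = 0` the diagonal term `η_0 l'` remains, which is the original path; for `i ≠ 0` it is
    -- cancelled by the summand `k = i`.
    by_cases h0 : i = 0
    · simp [h0]
    · rw [if_pos (Finset.mem_Ico.2 ⟨by omega, hi⟩), sub_self, if_neg h0]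
  · have hf : ∀ α, E.src α = u → ∀ y ∈ l.head?, ¬ D.Forbidden (.ghost α j) y := by
      intro α hα y hy hf
      cases l with
      | nil => simp at hy
      | cons z l =>
        simp only [List.head?_cons, Option.mem_def, Option.some.injEq] at hy
        subst hy
        cases z with
        | edge η k =>
          obtain ⟨h1, rfl, h3⟩ := hf
          exact h ⟨η, l, by rw [← h3, hα], h1, rfl⟩
        | ghost η k => exact hf
    rw [← D.sum_letterMap_edge_path_ghost hj hl hf]
    refine Finset.sum_congr rfl fun α hα => ?_
    rw [D.act_of_not_forbidden (hf α (mem_emitted.1 hα))]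

/-- The mirror image: the critical overlap is `α_i^* β_i β_j^*` with `β` special. After `β_i β_j^*`
is rewritten, only edges `γ ≠ β` remain, for which the sum over `i` is already known. -/
lemma sum_ghost_edge_single {α β : S} (hαβ : E.src α = E.src β) {m : ℕ} (hα : E.weight α ≤ m)
    (hβ : E.weight β ≤ m) [Decidable (α = β)]
    (l : List (Letter S)) (v : V) (hl : E.rng β = pathStart E l v) :
    ∑ i ∈ Finset.range m, D.letterMap R (.ghost α i) (D.act R (.edge β i) l v) =
      if α = β then D.path R l v else 0 := by
  classical
  by_cases hn : D.Normal l v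
  swap
  · simp [D.act_of_not_normal hn, D.path_of_not_normal hn]
  by_cases h : ∃ j l', β = D.special (E.src β) ∧ l = .ghost β j :: l'
  · obtain ⟨j, l', hsp, rfl⟩ := h
    have hj : j < E.weight β := hn.1
    have h1 : ∀ i, D.letterMap R (.ghost α i) (D.act R (.edge β i) (.ghost β j :: l') v) =
        (if i = j then D.path R (.ghost α j :: l') v else 0) -
        ∑ γ ∈ (E.emitted (E.src β)).erase β,
          D.letterMap R (.ghost α i) (D.path R (.edge γ i :: .ghost γ j :: l') v) := by
      intro i
      rw [D.act_of_forbidden hn (D.forbidden_edge_ghost hsp _ _), reduct, map_sub, map_sum]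
      congr 1
      split_ifs with h
      · subst h
        exact D.letterMap_path_of_not_forbidden (D.not_forbidden_ghost_of_normal hn hαβ)
      · rw [map_zero]
    rw [Finset.sum_congr rfl fun i _ => h1 i, Finset.sum_sub_distrib, Finset.sum_ite_eq',
      if_pos (Finset.mem_range.2 (hj.trans_le hβ)), Finset.sum_comm]
    have h2 : ∀ γ ∈ (E.emitted (E.src β)).erase β, ∑ i ∈ Finset.range m,
        D.letterMap R (.ghost α i) (D.path R (.edge γ i :: .ghost γ j :: l') v) =
        if α = γ then D.path R (.ghost γ j :: l') v else 0 := by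
      intro γ hγ
      have hs : E.src γ = E.src β := mem_emitted.1 (Finset.mem_of_mem_erase hγ)
      refine D.sum_letterMap_ghost_path_edge (hαβ.trans hs.symm) hα rfl ?_
      rintro i y hy hf
      simp only [List.head?_cons, Option.mem_def, Option.some.injEq] at hy
      subst hy
      exact Finset.ne_of_mem_erase hγ (D.special_eq hs hf.2 hsp)
    rw [Finset.sum_congr rfl h2, Finset.sum_ite_eq]
    -- For `α = β` the diagonal term remains, since `β` is erased from the sum; for `α ≠ β` it is
    -- cancelled by the summand `γ = α`.
    by_cases h0 : α = β
    · simp [h0]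
    · rw [if_pos (Finset.mem_erase.2 ⟨h0, mem_emitted.2 hαβ⟩), sub_self, if_neg h0]
  · have hf : ∀ i, ∀ y ∈ l.head?, ¬ D.Forbidden (.edge β i) y := by
      intro i y hy hf
      cases l with
      | nil => simp at hy
      | cons z l =>
        simp only [List.head?_cons, Option.mem_def, Option.some.injEq] at hy
        subst hy
        cases z with
        | edge η k => exact hf
        | ghost η k =>
          obtain ⟨rfl, h3⟩ := hf
          exact h ⟨k, l, h3, rfl⟩
    rw [← D.sum_letterMap_ghost_path_edge hαβ hα hl hf]
    refine Finset.sum_congr rfl fun i _ => ?_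
    rw [D.act_of_not_forbidden (hf i)]

/-- Relation (3) holds for the action on the path module. -/
lemma sum_letterMap_edge_ghost {u : V} {i j : ℕ} (hi : i < E.vertexWeight u)
    (hj : j < E.vertexWeight u) (n : PathModule R V S) :
    ∑ α ∈ E.emitted u, D.letterMap R (.edge α i) (D.letterMap R (.ghost α j) n) =
      if i = j then D.vertexMap R u n else 0 := by
  classical
  have : ∑ α ∈ E.emitted u, D.letterMap R (.edge α i) ∘ₗ D.letterMap R (.ghost α j) =
      if i = j then D.vertexMap R u else 0 := by
    refine linearMap_ext fun l v => ?_
    by_cases hl : u = pathStart E l v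
    · have := D.sum_edge_ghost_single (R := R) hi hj l v hl
      simp only [LinearMap.coe_sum, Finset.sum_apply, LinearMap.comp_apply, letterMap_single,
        one_smul, this]
      split_ifs with h
      · simp [hl]
      · simp
    · simp only [LinearMap.coe_sum, Finset.sum_apply, LinearMap.comp_apply, letterMap_single,
        one_smul]
      rw [Finset.sum_eq_zero]
      · split_ifs with h
        · simp [Ne.symm hl]
        · simp
      · intro α hα
        rw [D.act_of_finish_ne, map_zero]
        simpa [Letter.finish, mem_emitted.1 hα] using hl
  have h := LinearMap.congr_fun this n
  simp only [LinearMap.coe_sum, Finset.sum_apply, LinearMap.comp_apply] at h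
  rw [h]
  split_ifs <;> rfl

/-- Relation (4) holds for the action on the path module. -/
lemma sum_letterMap_ghost_edge (α β : S) [Decidable (α = β)] (n : PathModule R V S) :
    ∑ i ∈ Finset.range (max (E.weight α) (E.weight β)),
      D.letterMap R (.ghost α i) (D.letterMap R (.edge β i) n) =
      if α = β then D.vertexMap R (E.rng α) n else 0 := by
  classical
  by_cases hαβ : E.src α = E.src β
  swap
  · rw [if_neg fun h => hαβ (congrArg E.src h)]
    refine Finset.sum_eq_zero fun i _ => ?_
    -- Inserting the source of `β` between the two letters kills the product when the sources
    -- differ.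
    rw [← D.vertexMap_start_letterMap (.edge β i), letterMap_vertexMap]
    exact if_neg hαβ
  have : ∑ i ∈ Finset.range (max (E.weight α) (E.weight β)),
      D.letterMap R (.ghost α i) ∘ₗ D.letterMap R (.edge β i) =
      if α = β then D.vertexMap R (E.rng α) else 0 := by
    refine linearMap_ext fun l v => ?_
    by_cases hl : E.rng β = pathStart E l v
    · have := D.sum_ghost_edge_single (R := R) hαβ (le_max_left _ _) (le_max_right _ _) l v hl
      simp only [LinearMap.coe_sum, Finset.sum_apply, LinearMap.comp_apply, letterMap_single,
        one_smul, this]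
      split_ifs with h
      · simp [h, hl]
      · simp
    · simp only [LinearMap.coe_sum, Finset.sum_apply, LinearMap.comp_apply, letterMap_single,
        one_smul]
      rw [Finset.sum_eq_zero]
      · split_ifs with h
        · simp [h, Ne.symm hl]
        · simp
      · intro i _
        rw [D.act_of_finish_ne, map_zero]
        simpa [Letter.finish] using hl
  have h := LinearMap.congr_fun this n
  simp only [LinearMap.coe_sum, Finset.sum_apply, LinearMap.comp_apply] at h
  rw [h]
  split_ifs <;> rfl

end Relations

end SpecialEdges

/-! ### Lifting to monoid algebras and computing in the quotient -/

/-- A non-unital variant of `MonoidAlgebra.liftNCRingHom`. -/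
noncomputable def liftNCNonUnital {k G A : Type*} [Semiring k] [Semigroup G] [Semiring A]
    (f : k →+* A) (g : G →ₙ* A) (h : ∀ r a, Commute (f r) (g a)) : MonoidAlgebra k G →ₙ+* A :=
  { MonoidAlgebra.liftNC (f : k →+ A) g with
    map_mul' := fun x y => MonoidAlgebra.liftNC_mul f g x y fun {_ _} _ => h _ _ }

lemma liftNCNonUnital_single {k G A : Type*} [Semiring k] [Semigroup G] [Semiring A]
    (f : k →+* A) (g : G →ₙ* A) (h : ∀ r a, Commute (f r) (g a)) (a : G) (r : k) :
    liftNCNonUnital f g h (MonoidAlgebra.single a r) = f r * g a :=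
  MonoidAlgebra.liftNC_single _ _ _ _

section LeavittPathAlgebra

variable (R : Type w) [Ring R] (E)

/-- The quotient map onto the weighted Leavitt path algebra. -/
noncomputable def toLPA : FreeRRing R E →ₙ+* LeavittPathAlgebra R E where
  toFun x := (x : (leavittIdeal R E).ringCon.Quotient)
  map_mul' _ _ := rfl
  map_zero' := rfl
  map_add' _ _ := rfl

variable {R E}

lemma toLPA_surjective : Function.Surjective (toLPA E R) := Quotient.mk_surjective

lemma toLPA_eq_iff {x y : FreeRRing R E} : toLPA E R x = toLPA E R y ↔ x - y ∈ leavittIdeal R E :=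
  (RingCon.eq _).trans (TwoSidedIdeal.rel_iff _ _ _)

lemma smul_mem_leavittIdeal (r : R) {x : FreeRRing R E} (hx : x ∈ leavittIdeal R E) :
    r • x ∈ leavittIdeal R E := by
  rw [leavittIdeal, TwoSidedIdeal.mem_sInf] at hx ⊢
  exact fun J hJ => hJ.1 r x (hx J hJ)

lemma toLPA_smul_congr (r : R) {x y : FreeRRing R E} (h : toLPA E R x = toLPA E R y) :
    toLPA E R (r • x) = toLPA E R (r • y) := by
  rw [toLPA_eq_iff] at h ⊢
  rw [← smul_sub]
  exact smul_mem_leavittIdeal r h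

lemma toLPA_eq_of_rel {x y : FreeRRing R E} (h : LeavittRel R E x y) :
    toLPA E R x = toLPA E R y := by
  rw [toLPA_eq_iff, leavittIdeal, TwoSidedIdeal.mem_sInf]
  exact fun J hJ => hJ.2.2 _ _ h

lemma gen_mul_smul (g : E.Generator) (r : R) (x : FreeRRing R E) :
    gen R E g * r • x = r • (gen R E g * x) := by
  induction x using MonoidAlgebra.induction_linear with
  | zero => simp
  | add x y hx hy => rw [smul_add, mul_add, hx, hy, mul_add, smul_add]
  | single a s => simp [gen]

/-- Induction principle for the free `R`-ring. -/
lemma FreeRRing.induction {p : FreeRRing R E → Prop} (zero : p 0)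
    (gen : ∀ g, p (gen R E g)) (mul : ∀ x y, p x → p y → p (x * y))
    (add : ∀ x y, p x → p y → p (x + y)) (smul : ∀ (r : R) x, p x → p (r • x))
    (x : FreeRRing R E) : p x := by
  have key (a : FreeSemigroup E.Generator) : p (MonoidAlgebra.single a 1) := by
    induction a using FreeSemigroup.recOnMul with
    | ih1 g => exact gen g
    | ih2 g a hg ha => simpa using mul _ _ hg ha
  induction x using MonoidAlgebra.induction_linear with
  | zero => exact zero
  | add x y hx hy => exact add x y hx hy
  | single a r => simpa using smul r _ (key a)

variable (R) in
/-- A letter as an element of the free `R`-ring. -/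
noncomputable def letterElem : Letter S → FreeRRing R E
  | .edge α i => edg R E α i
  | .ghost α i => gho R E α i

lemma letterElem_of_not_valid {x : Letter S} (h : ¬ x.Valid E) :
    letterElem R (E := E) x = 0 := by
  cases x <;> exact dif_neg h

lemma toLPA_vtx_mul_letter (x : Letter S) :
    toLPA E R (vtx R E (x.start E)) * toLPA E R (letterElem R x) = toLPA E R (letterElem R x) := by
  by_cases h : x.Valid E
  · rw [← map_mul]
    cases x with
    | edge α i => exact toLPA_eq_of_rel (.src_mul_edge α i h)
    | ghost α i => exact toLPA_eq_of_rel (.rng_mul_ghost α i h)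
  · simp [letterElem_of_not_valid h]

lemma toLPA_letter_mul_vtx (x : Letter S) :
    toLPA E R (letterElem R x) * toLPA E R (vtx R E (x.finish E)) = toLPA E R (letterElem R x) := by
  by_cases h : x.Valid E
  · rw [← map_mul]
    cases x with
    | edge α i => exact toLPA_eq_of_rel (.edge_mul_rng α i h)
    | ghost α i => exact toLPA_eq_of_rel (.ghost_mul_src α i h)
  · simp [letterElem_of_not_valid h]

lemma toLPA_vtx_mul_vtx (u v : V) [Decidable (u = v)] :
    toLPA E R (vtx R E u) * toLPA E R (vtx R E v) =
      if u = v then toLPA E R (vtx R E u) else 0 := by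
  rw [← map_mul, toLPA_eq_of_rel (.vertex_mul u v)]
  split_ifs <;> simp

lemma toLPA_sum_edge_ghost {u : V} {i j : ℕ} (hi : i < E.vertexWeight u)
    (hj : j < E.vertexWeight u) :
    ∑ α ∈ E.emitted u, toLPA E R (letterElem R (.edge α i)) * toLPA E R (letterElem R (.ghost α j)) =
      if i = j then toLPA E R (vtx R E u) else 0 := by
  have := toLPA_eq_of_rel (LeavittRel.sum_edge_ghost (R := R) u i j hi hj)
  rw [map_sum] at this
  simp only [map_mul] at this
  simp only [letterElem, this]
  split_ifs <;> simp

lemma toLPA_sum_ghost_edge (α β : S) [Decidable (α = β)] :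
    ∑ i ∈ Finset.range (max (E.weight α) (E.weight β)),
      toLPA E R (letterElem R (.ghost α i)) * toLPA E R (letterElem R (.edge β i)) =
      if α = β then toLPA E R (vtx R E (E.rng α)) else 0 := by
  have := toLPA_eq_of_rel (LeavittRel.sum_ghost_edge (R := R) (E := E) α β)
  rw [map_sum] at this
  simp only [map_mul] at this
  simp only [letterElem, this]
  split_ifs <;> simp

variable (R) in
/-- The word `l`, followed by the vertex `v`, as an element of the free `R`-ring. -/
noncomputable def word : List (Letter S) → V → FreeRRing R E
  | [], v => vtx R E v
  | x :: l, v => letterElem R x * word l v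

lemma toLPA_vtx_mul_word (l : List (Letter S)) (v : V) :
    toLPA E R (vtx R E (pathStart E l v)) * toLPA E R (word R l v) = toLPA E R (word R l v) := by
  classical
  cases l with
  | nil => exact (toLPA_vtx_mul_vtx v v).trans (if_pos rfl)
  | cons x l =>
    rw [word, map_mul, ← mul_assoc, pathStart, toLPA_vtx_mul_letter]

lemma toLPA_vtx_mul_word' (u : V) (l : List (Letter S)) (v : V) [Decidable (pathStart E l v = u)] :
    toLPA E R (vtx R E u) * toLPA E R (word R l v) =
      if pathStart E l v = u then toLPA E R (word R l v) else 0 := by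
  classical
  rw [← toLPA_vtx_mul_word, ← mul_assoc, toLPA_vtx_mul_vtx]
  split_ifs with h1 h2 h2
  · rw [h1]
  · exact absurd h1.symm h2
  · exact absurd h2.symm h1
  · simp

lemma toLPA_letter_mul_word_of_ne {x : Letter S} {l : List (Letter S)} {v : V}
    (h : x.finish E ≠ pathStart E l v) :
    toLPA E R (letterElem R x) * toLPA E R (word R l v) = 0 := by
  classical
  rw [← toLPA_letter_mul_vtx, mul_assoc, toLPA_vtx_mul_word', if_neg h.symm, mul_zero]

end LeavittPathAlgebra

/-! ### The representation on the path module and its faithfulness -/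

namespace SpecialEdges

variable (D : SpecialEdges E)

/-- This is why rewriting stops after one step: `γ_j^*` tolerates the same right neighbours as
`α_j^*`, because forbiddenness of a ghost edge followed by an edge depends only on the source and
the indices. -/
lemma Normal.edge_ghost {α γ : S} {i j : ℕ} {l : List (Letter S)} {v : V}
    (h : D.Normal (.ghost α j :: l) v) (hs : E.src γ = E.src α) (hγ : γ ≠ D.special (E.src γ))
    (hi : i < E.weight γ) (hj : j < E.weight γ) : D.Normal (.edge γ i :: .ghost γ j :: l) v := by
  refine ⟨hi, rfl, ?_, hj, hs.trans h.2.1, D.not_forbidden_ghost_of_normal h hs, h.tail⟩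
  intro y hy hf
  simp only [List.head?_cons, Option.mem_def, Option.some.injEq] at hy
  subst hy
  exact hγ hf.2

lemma Normal.ghost_edge {α β : S} {i k : ℕ} {l : List (Letter S)} {v : V}
    (h : D.Normal (.edge β i :: l) v) (hs : E.src α = E.src β) (hk : k ≠ 0)
    (hα : k < E.weight α) (hβ : k < E.weight β) : D.Normal (.ghost α k :: .edge β k :: l) v := by
  refine ⟨hα, hs, ?_, hβ, h.2.1, D.not_forbidden_edge_of_normal h, h.tail⟩
  intro y hy hf
  simp only [List.head?_cons, Option.mem_def, Option.some.injEq] at hy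
  subst hy
  exact hk hf.1

section Representation

variable (R : Type w) [Ring R]

/-- The endomorphism of the path module given by a generator. -/
noncomputable def genMap : E.Generator → PathModule R V S →ₗ[R] PathModule R V S
  | .vertex u => D.vertexMap R u
  | .edge α i => D.letterMap R (.edge α i)
  | .ghost α i => D.letterMap R (.ghost α i)

/-- The action of words in the generators on the path module. -/
noncomputable def wordMap : FreeSemigroup E.Generator →ₙ* AddMonoid.End (PathModule R V S) :=
  FreeSemigroup.lift fun g => (D.genMap R g).toAddMonoidHom

/-- For noncommutative `R` scalar multiplication is merely additive, so the representation takes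
values in additive endomorphisms. Left linearity of the letters provides the commutation needed to
lift to the monoid algebra. -/
lemma wordMap_smul (a : FreeSemigroup E.Generator) (r : R) (n : PathModule R V S) :
    D.wordMap R a (r • n) = r • D.wordMap R a n := by
  induction a using FreeSemigroup.recOnMul generalizing n with
  | ih1 g => exact (D.genMap R g).map_smul r n
  | ih2 g a hg ha =>
    rw [map_mul]
    exact (congrArg _ (ha n)).trans (hg _)

lemma commute_wordMap (r : R) (a : FreeSemigroup E.Generator) :
    Commute (Module.toAddMonoidEnd R (PathModule R V S) r) (D.wordMap R a) :=
  AddMonoidHom.ext fun n => (D.wordMap_smul R a r n).symm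

/-- The action of the free `R`-ring on the path module. -/
noncomputable def rep : FreeRRing R E →ₙ+* AddMonoid.End (PathModule R V S) :=
  liftNCNonUnital (Module.toAddMonoidEnd R (PathModule R V S)) (D.wordMap R) (D.commute_wordMap R)

variable {R}

lemma rep_single (a : FreeSemigroup E.Generator) (r : R) (n : PathModule R V S) :
    D.rep R (MonoidAlgebra.single a r) n = r • D.wordMap R a n := by
  rw [rep, liftNCNonUnital_single]
  rfl

lemma rep_mul (x y : FreeRRing R E) (n : PathModule R V S) :
    D.rep R (x * y) n = D.rep R x (D.rep R y n) := by
  rw [map_mul]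
  rfl

lemma rep_add (x y : FreeRRing R E) (n : PathModule R V S) :
    D.rep R (x + y) n = D.rep R x n + D.rep R y n := by
  rw [map_add]
  rfl

lemma rep_sum {ι : Type*} (s : Finset ι) (f : ι → FreeRRing R E) (n : PathModule R V S) :
    D.rep R (∑ i ∈ s, f i) n = ∑ i ∈ s, D.rep R (f i) n := by
  rw [map_sum]
  exact AddMonoidHom.finsetSum_apply _ _ _

@[simp]
lemma rep_zero (n : PathModule R V S) : D.rep R 0 n = 0 := by
  rw [map_zero]
  rfl

lemma rep_smul (r : R) (x : FreeRRing R E) (n : PathModule R V S) :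
    D.rep R (r • x) n = r • D.rep R x n := by
  induction x using MonoidAlgebra.induction_linear with
  | zero => simp
  | add x y hx hy => rw [smul_add, rep_add, hx, hy, rep_add, smul_add]
  | single a s => rw [MonoidAlgebra.smul_single, rep_single, rep_single, smul_smul, smul_eq_mul]

lemma rep_op_smul (r : R) (x : FreeRRing R E) (n : PathModule R V S) :
    D.rep R (MulOpposite.op r • x) n = D.rep R x (r • n) := by
  induction x using MonoidAlgebra.induction_linear with
  | zero => simp
  | add x y hx hy => rw [smul_add, rep_add, hx, hy, rep_add]
  | single a s =>
    rw [MonoidAlgebra.smul_single, rep_single, rep_single, wordMap_smul, smul_smul, op_smul_eq_mul]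

lemma rep_gen (g : E.Generator) (n : PathModule R V S) :
    D.rep R (gen R E g) n = D.genMap R g n := by
  refine (D.rep_single _ _ _).trans ?_
  rw [one_smul]
  rfl

lemma rep_vtx (u : V) (n : PathModule R V S) : D.rep R (vtx R E u) n = D.vertexMap R u n :=
  D.rep_gen _ n

lemma rep_letterElem (x : Letter S) (n : PathModule R V S) :
    D.rep R (letterElem R x) n = D.letterMap R x n := by
  by_cases h : x.Valid E
  · cases x with
    | edge α i => exact (congrArg (D.rep R · n) (dif_pos h)).trans (D.rep_gen _ n)
    | ghost α i => exact (congrArg (D.rep R · n) (dif_pos h)).trans (D.rep_gen _ n)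
  · rw [letterElem_of_not_valid h, D.letterMap_of_not_valid h, rep_zero, LinearMap.zero_apply]

lemma rep_edg (α : S) (i : ℕ) (n : PathModule R V S) :
    D.rep R (edg R E α i) n = D.letterMap R (.edge α i) n := D.rep_letterElem (.edge α i) n

lemma rep_gho (α : S) (i : ℕ) (n : PathModule R V S) :
    D.rep R (gho R E α i) n = D.letterMap R (.ghost α i) n := D.rep_letterElem (.ghost α i) n

lemma rep_eq_of_rel {x y : FreeRRing R E} (h : LeavittRel R E x y) (n : PathModule R V S) :
    D.rep R x n = D.rep R y n := by
  classical
  cases h with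
  | vertex_mul v w =>
    rw [rep_mul, rep_vtx, rep_vtx, vertexMap_vertexMap]
    split_ifs
    · rw [rep_vtx]
    · rw [rep_zero]
  | src_mul_edge α i hi =>
    rw [rep_mul, rep_vtx, rep_edg]
    exact D.vertexMap_start_letterMap (.edge α i) n
  | edge_mul_rng α i hi =>
    rw [rep_mul, rep_vtx, rep_edg, rep_edg]
    exact D.letterMap_vertexMap_finish (.edge α i) n
  | rng_mul_ghost α i hi =>
    rw [rep_mul, rep_vtx, rep_gho]
    exact D.vertexMap_start_letterMap (.ghost α i) n
  | ghost_mul_src α i hi =>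
    rw [rep_mul, rep_vtx, rep_gho, rep_gho]
    exact D.letterMap_vertexMap_finish (.ghost α i) n
  | sum_edge_ghost v i j hi hj =>
    simp only [rep_sum, rep_mul, rep_edg, rep_gho]
    rw [D.sum_letterMap_edge_ghost hi hj]
    split_ifs
    · rw [rep_vtx]
    · rw [rep_zero]
  | sum_ghost_edge α β =>
    simp only [rep_sum, rep_mul, rep_edg, rep_gho]
    rw [D.sum_letterMap_ghost_edge]
    split_ifs
    · rw [rep_vtx]
    · rw [rep_zero]

lemma rep_sub (x y : FreeRRing R E) (n : PathModule R V S) :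
    D.rep R (x - y) n = D.rep R x n - D.rep R y n := by
  rw [eq_sub_iff_add_eq, ← rep_add, sub_add_cancel]

lemma mem_ker_rep_iff {x : FreeRRing R E} :
    x ∈ TwoSidedIdeal.ker (D.rep R) ↔ ∀ n, D.rep R x n = 0 :=
  (TwoSidedIdeal.mem_ker _).trans DFunLike.ext_iff

/-- The kernel of the representation is itself closed under both scalar actions and contains the
relations, hence is among the ideals being intersected. -/
lemma rep_of_mem {x : FreeRRing R E} (hx : x ∈ leavittIdeal R E) (n : PathModule R V S) :
    D.rep R x n = 0 := by
  rw [leavittIdeal, TwoSidedIdeal.mem_sInf] at hx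
  refine D.mem_ker_rep_iff.1 (hx _ ⟨fun r y hy => ?_, fun r y hy => ?_, fun y z h => ?_⟩) n
  · rw [mem_ker_rep_iff] at hy ⊢
    intro n
    rw [rep_smul, hy, smul_zero]
  · rw [mem_ker_rep_iff] at hy ⊢
    intro n
    rw [rep_op_smul, hy]
  · rw [mem_ker_rep_iff]
    intro n
    rw [rep_sub, D.rep_eq_of_rel h, sub_self]

lemma rep_congr {x y : FreeRRing R E} (h : toLPA E R x = toLPA E R y) (n : PathModule R V S) :
    D.rep R x n = D.rep R y n := by
  rw [← sub_eq_zero, ← rep_sub]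
  exact D.rep_of_mem (toLPA_eq_iff.1 h) n

open Classical in
variable (R) in
/-- The linear map from the path module to the free `R`-ring that sends normal paths to words. -/
noncomputable def embed : PathModule R V S →ₗ[R] FreeRRing R E :=
  Finsupp.linearCombination R fun p => if D.Normal p.1 p.2 then word R p.1 p.2 else 0

open Classical in
lemma embed_single (l : List (Letter S)) (v : V) (r : R) :
    D.embed R (Finsupp.single (l, v) r) = r • if D.Normal l v then word R l v else 0 := by
  simp [embed]

lemma embed_path {l : List (Letter S)} {v : V} (h : D.Normal l v) :
    D.embed R (D.path R l v) = word R l v := by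
  rw [D.path_of_normal h, embed_single, if_pos h, one_smul]

/-- The normal form is a defining relation solved for the forbidden pair, so moving the sum to the
other side restores that relation. Terms with an index out of range vanish on both sides. -/
lemma toLPA_embed_reduct {x y : Letter S} {l : List (Letter S)} {v : V}
    (hn : D.Normal (y :: l) v) (hx : x.Valid E) (hf : D.Forbidden x y) :
    toLPA E R (letterElem R x * word R (y :: l) v) =
      toLPA E R (D.embed R (D.reduct R x y l v)) := by
  classical
  obtain ⟨α, i, j, hα, rfl, rfl⟩ | ⟨α, β, hα, rfl, rfl⟩ := hf.cases
  · have hi : i < E.weight α := hx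
    have hj : j < E.weight α := hn.1
    have hw := weight_le_vertexWeight (E := E) α
    have h1 : ∀ γ ∈ (E.emitted (E.src α)).erase α,
        toLPA E R (D.embed R (D.path R (.edge γ i :: .ghost γ j :: l) v)) =
        toLPA E R (letterElem R (.edge γ i)) * toLPA E R (letterElem R (.ghost γ j)) *
          toLPA E R (word R l v) := by
      intro γ hγ
      have hs : E.src γ = E.src α := mem_emitted.1 (Finset.mem_of_mem_erase hγ)
      by_cases hiγ : i < E.weight γ
      · by_cases hjγ : j < E.weight γ
        · rw [D.embed_path, word, word, map_mul, map_mul, mul_assoc]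
          refine Normal.edge_ghost D hn hs (fun h => ?_) hiγ hjγ
          exact Finset.ne_of_mem_erase hγ (D.special_eq hs h hα)
        · rw [letterElem_of_not_valid (x := .ghost γ j) hjγ, D.path_of_not_normal]
          · simp
          · exact fun h => hjγ h.tail.1
      · rw [letterElem_of_not_valid (x := .edge γ i) hiγ, D.path_of_not_normal]
        · simp
        · exact fun h => hiγ h.1
    rw [reduct, map_sub, map_sub, map_sum, map_sum, Finset.sum_congr rfl h1, ← Finset.sum_mul,
      eq_sub_iff_add_eq, word, map_mul, map_mul, ← mul_assoc, ← add_mul,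
      Finset.add_sum_erase (E.emitted (E.src α)) (fun γ => toLPA E R (letterElem R (.edge γ i)) *
        toLPA E R (letterElem R (.ghost γ j))) (mem_emitted.2 rfl),
      toLPA_sum_edge_ghost (hi.trans_le hw) (hj.trans_le hw)]
    split_ifs
    · rw [D.embed_path hn.tail]
      have h3 : E.src α = pathStart E l v := hn.2.1
      rw [h3, toLPA_vtx_mul_word]
    · simp
  · have hw := D.two_le_weight α
    have h1 : ∀ k ∈ Finset.Ico 1 (E.weight α),
        toLPA E R (D.embed R (D.path R (.ghost α k :: .edge β k :: l) v)) =
        toLPA E R (letterElem R (.ghost α k)) * toLPA E R (letterElem R (.edge β k)) *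
          toLPA E R (word R l v) := by
      intro k hk
      rw [Finset.mem_Ico] at hk
      by_cases hβ : k < E.weight β
      · rw [D.embed_path, word, word, map_mul, map_mul, mul_assoc]
        exact Normal.ghost_edge D hn hα (by omega) hk.2 hβ
      · rw [letterElem_of_not_valid (x := .edge β k) hβ, D.path_of_not_normal]
        · simp
        · exact fun h => hβ h.tail.1
    rw [reduct, map_sub, map_sub, map_sum, map_sum, Finset.sum_congr rfl h1, ← Finset.sum_mul,
      eq_sub_iff_add_eq, word, map_mul, map_mul, ← mul_assoc, ← add_mul,
      ← Finset.sum_eq_sum_Ico_succ_bot (f := fun k => toLPA E R (letterElem R (.ghost α k)) *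
        toLPA E R (letterElem R (.edge β k))) (by omega : 0 < E.weight α), ← Finset.range_eq_Ico,
      Finset.sum_subset (s₂ := Finset.range (max (E.weight α) (E.weight β)))
        (Finset.range_subset_range.2 (le_max_left _ _)), toLPA_sum_ghost_edge]
    · split_ifs with h
      · rw [D.embed_path hn.tail]
        have h3 : E.rng β = pathStart E l v := hn.2.1
        rw [h, h3, toLPA_vtx_mul_word]
      · simp
    · intro k _ hk
      rw [letterElem_of_not_valid (x := .ghost α k) fun h => hk (Finset.mem_range.2 h), map_zero,
        zero_mul]

lemma toLPA_letter_mul_word {x : Letter S} (hx : x.Valid E) {l : List (Letter S)} {v : V}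
    (hn : D.Normal l v) : toLPA E R (letterElem R x * word R l v) =
      toLPA E R (D.embed R (D.act R x l v)) := by
  by_cases h : ∃ y l', l = y :: l' ∧ D.Forbidden x y
  · obtain ⟨y, l', rfl, hf⟩ := h
    rw [D.act_of_forbidden hn hf, D.toLPA_embed_reduct hn hx hf]
  · have hf : ∀ y ∈ l.head?, ¬ D.Forbidden x y := by
      intro y hy hf
      cases l with
      | nil => simp at hy
      | cons z l =>
        simp only [List.head?_cons, Option.mem_def, Option.some.injEq] at hy
        subst hy
        exact h ⟨_, _, rfl, hf⟩
    rw [D.act_of_not_forbidden hf]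
    by_cases hs : x.finish E = pathStart E l v
    · have : D.Normal (x :: l) v := ⟨hx, hs, hf, hn⟩
      rw [D.embed_path this, word]
    · rw [D.path_cons_of_finish_ne hs, map_mul, toLPA_letter_mul_word_of_ne hs, map_zero, map_zero]

lemma toLPA_gen_mul_word (g : E.Generator) {l : List (Letter S)} {v : V} (hn : D.Normal l v) :
    toLPA E R (gen R E g * word R l v) =
      toLPA E R (D.embed R (D.genMap R g (Finsupp.single (l, v) 1))) := by
  classical
  cases g with
  | vertex u =>
    rw [genMap, vertexMap_single, one_smul, map_mul]
    refine (toLPA_vtx_mul_word' u l v).trans ?_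
    split_ifs
    · rw [D.embed_path hn]
    · simp
  | edge α i =>
    rw [genMap, letterMap_single, one_smul, ← D.toLPA_letter_mul_word (x := .edge α i) i.2 hn,
      letterElem, edg, dif_pos]
  | ghost α i =>
    rw [genMap, letterMap_single, one_smul, ← D.toLPA_letter_mul_word (x := .ghost α i) i.2 hn,
      letterElem, gho, dif_pos]

lemma genMap_single_of_not_normal (g : E.Generator) {l : List (Letter S)} {v : V}
    (hn : ¬ D.Normal l v) : D.genMap R g (Finsupp.single (l, v) 1) = 0 := by
  classical
  cases g <;> simp [genMap, D.act_of_not_normal hn, D.path_of_not_normal hn]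

/-- The map `embed` intertwines the left multiplication with the action on the path module,
modulo the defining relations. -/
lemma toLPA_mul_embed (x : FreeRRing R E) (n : PathModule R V S) :
    toLPA E R (x * D.embed R n) = toLPA E R (D.embed R (D.rep R x n)) := by
  classical
  induction x using FreeRRing.induction generalizing n with
  | zero => simp
  | gen g =>
    rw [rep_gen]
    induction n using Finsupp.induction_linear with
    | zero => simp
    | add m n hm hn => rw [map_add, mul_add, map_add, hm, hn, map_add, map_add, map_add]
    | single p r =>
      obtain ⟨l, v⟩ := p
      have : Finsupp.single (l, v) r = r • Finsupp.single (l, v) (1 : R) := by simp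
      rw [this, map_smul, map_smul, map_smul, gen_mul_smul]
      refine toLPA_smul_congr r ?_
      rw [embed_single, one_smul]
      split_ifs with h
      · exact D.toLPA_gen_mul_word g h
      · simp [D.genMap_single_of_not_normal g h]
  | mul x y hx hy =>
    rw [mul_assoc, map_mul, hy, ← map_mul, hx, rep_mul]
  | add x y hx hy => rw [add_mul, map_add, hx, hy, rep_add, map_add, map_add]
  | smul r x hx =>
    rw [smul_mul_assoc, rep_smul, (D.embed R).map_smul]
    exact toLPA_smul_congr r (hx n)

/-- Modulo the defining relations every element has a finite set of vertices as right unit. -/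
lemma exists_toLPA_mul_sum_vtx (x : FreeRRing R E) : ∃ s : Finset V, ∀ t, s ⊆ t →
    toLPA E R (x * ∑ v ∈ t, vtx R E v) = toLPA E R x := by
  classical
  have key (g : FreeRRing R E) (v : V) (h : toLPA E R g * toLPA E R (vtx R E v) = toLPA E R g)
      (t : Finset V) (ht : v ∈ t) : toLPA E R (g * ∑ v ∈ t, vtx R E v) = toLPA E R g := by
    rw [map_mul, map_sum, ← h, mul_assoc, Finset.mul_sum]
    simp [toLPA_vtx_mul_vtx, ht]
  induction x using FreeRRing.induction with
  | zero => exact ⟨∅, by simp⟩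
  | gen g =>
    cases g with
    | vertex u =>
      refine ⟨{u}, fun t ht => key _ u ?_ t (by simpa using ht)⟩
      exact (toLPA_vtx_mul_vtx u u).trans (if_pos rfl)
    | edge α i =>
      refine ⟨{E.rng α}, fun t ht => key _ (E.rng α) ?_ t (by simpa using ht)⟩
      have := toLPA_letter_mul_vtx (R := R) (E := E) (.edge α i)
      rwa [letterElem, edg, dif_pos i.2] at this
    | ghost α i =>
      refine ⟨{E.src α}, fun t ht => key _ (E.src α) ?_ t (by simpa using ht)⟩
      have := toLPA_letter_mul_vtx (R := R) (E := E) (.ghost α i)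
      rwa [letterElem, gho, dif_pos i.2] at this
  | mul x y hx hy =>
    obtain ⟨s, hs⟩ := hy
    refine ⟨s, fun t ht => ?_⟩
    rw [mul_assoc, map_mul, hs t ht, map_mul]
  | add x y hx hy =>
    obtain ⟨s, hs⟩ := hx
    obtain ⟨s', hs'⟩ := hy
    refine ⟨s ∪ s', fun t ht => ?_⟩
    rw [add_mul, map_add, hs t (Finset.union_subset_left ht), hs' t (Finset.union_subset_right ht),
      map_add]
  | smul r x hx =>
    obtain ⟨s, hs⟩ := hx
    refine ⟨s, fun t ht => ?_⟩
    rw [smul_mul_assoc]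
    exact toLPA_smul_congr r (hs t ht)

/-- The vertex `v` is the image of the trivial path under `embed`, so `x v` has a normal form that
can be read off from the action of `x` on that path. -/
lemma toLPA_mul_vtx (x : FreeRRing R E) (v : V) :
    toLPA E R (x * vtx R E v) = toLPA E R (D.embed R (D.rep R x (Finsupp.single ([], v) 1))) := by
  rw [← toLPA_mul_embed, embed_single, one_smul, if_pos (by trivial), word]

/-- The action of the weighted Leavitt path algebra on the path module is faithful. -/
lemma exists_rep_ne_zero {x : FreeRRing R E} (hx : toLPA E R x ≠ 0) :
    ∃ v, D.rep R x (Finsupp.single ([], v) 1) ≠ 0 := by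
  by_contra! h
  obtain ⟨s, hs⟩ := exists_toLPA_mul_sum_vtx x
  apply hx
  rw [← hs s subset_rfl, Finset.mul_sum, map_sum]
  refine Finset.sum_eq_zero fun v _ => ?_
  rw [D.toLPA_mul_vtx, h v, map_zero, map_zero]

end Representation

/-! ### Words of maximal length in a product of normal paths -/

lemma Normal.of_append {l k : List (Letter S)} {v : V} (h : D.Normal (l ++ k) v) :
    D.Normal k v := by
  induction l with
  | nil => exact h
  | cons x l ih => exact ih (Normal.tail D h)

/-- Normal paths can be glued along a letter `x`, which may be replaced by a similar letter `y`. -/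
lemma Normal.append {l k : List (Letter S)} {x y : Letter S} {u v : V}
    (hx : D.Normal (l ++ [x]) u) (hy : D.Normal (y :: k) v) (hs : y.start E = x.start E)
    (hf : ∀ z, D.Forbidden z y → D.Forbidden z x) : D.Normal (l ++ y :: k) v := by
  induction l with
  | nil => exact hy
  | cons z l ih =>
    obtain ⟨h1, h2, h3, h4⟩ := hx
    refine ⟨h1, ?_, ?_, ih h4⟩
    · rw [h2]
      cases l
      · exact hs.symm
      · rfl
    · cases l with
      | nil =>
        intro t ht hf'
        obtain rfl : y = t := Option.some.inj ht
        exact h3 x (by simp) (hf _ hf')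
      | cons t l => exact h3

/-- `Swap x y x' y'` means that, up to sign, `x y` occurs in the normal form of the forbidden
word `x' y'`. -/
inductive Swap : Letter S → Letter S → Letter S → Letter S → Prop
  | edge_ghost (γ : S) (i j : ℕ) (h : γ ≠ D.special (E.src γ)) :
      Swap (.edge γ i) (.ghost γ j)
        (.edge (D.special (E.src γ)) i) (.ghost (D.special (E.src γ)) j)
  | ghost_edge (α β : S) (k : ℕ) (hk : k ≠ 0) (h : E.src α = E.src β) :
      Swap (.ghost α k) (.edge β k) (.ghost α 0) (.edge β 0)

lemma Swap.forbidden {x y x' y' : Letter S} (h : D.Swap x y x' y') : D.Forbidden x' y' := by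
  cases h with
  | edge_ghost γ i j h => exact D.forbidden_edge_ghost (by rw [D.src_special]) _ _
  | ghost_edge α β k hk h => exact D.forbidden_ghost_edge h

/-- Each pair arises from at most one forbidden pair, so a coefficient of the product receives at
most one correction term. -/
lemma Swap.unique {x y x' y' x'' y'' : Letter S} (h : D.Swap x y x' y')
    (h' : D.Swap x y x'' y'') : x'' = x' ∧ y'' = y' := by
  cases h <;> cases h' <;> exact ⟨rfl, rfl⟩

section Action

variable {R : Type w} [Ring R]

/-- Rewriting never lengthens a word and keeps the end vertex. Phrased with a submodule, this yields
both the support condition and the length bound. -/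
lemma act_mem {M : Submodule R (PathModule R V S)} (x : Letter S) {l : List (Letter S)} {v : V}
    (h : ∀ l', l'.length ≤ l.length + 1 → D.path R l' v ∈ M) : D.act R x l v ∈ M := by
  by_cases hn : D.Normal l v
  swap
  · rw [D.act_of_not_normal hn]
    exact M.zero_mem
  by_cases hf : ∃ y l', l = y :: l' ∧ D.Forbidden x y
  · obtain ⟨y, l', rfl, hf⟩ := hf
    rw [D.act_of_forbidden hn hf]
    obtain ⟨α, i, j, hα, rfl, rfl⟩ | ⟨α, β, hα, rfl, rfl⟩ := hf.cases
    · refine M.sub_mem ?_ (M.sum_mem fun γ _ => h _ (by simp))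
      split_ifs
      · exact h _ (by simp; omega)
      · exact M.zero_mem
    · refine M.sub_mem ?_ (M.sum_mem fun γ _ => h _ (by simp))
      split_ifs
      · exact h _ (by simp; omega)
      · exact M.zero_mem
  · rw [D.act_of_not_forbidden]
    · exact h _ (by simp)
    · intro y hy hf'
      cases l with
      | nil => simp at hy
      | cons z l =>
        simp only [List.head?_cons, Option.mem_def, Option.some.injEq] at hy
        subst hy
        exact hf ⟨_, _, rfl, hf'⟩

lemma path_mem_supported {s : Set (List (Letter S) × V)} {l : List (Letter S)} {v : V}
    (h : D.Normal l v → (l, v) ∈ s) : D.path R l v ∈ Finsupp.supported R R s := by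
  by_cases hn : D.Normal l v
  · rw [D.path_of_normal hn]
    exact Finsupp.single_mem_supported _ _ (h hn)
  · rw [D.path_of_not_normal hn]
    exact Submodule.zero_mem _

lemma linearMap_mem_of_supported {f : PathModule R V S →ₗ[R] PathModule R V S}
    {s : Set (List (Letter S) × V)} {M : Submodule R (PathModule R V S)}
    (h : ∀ l v, (l, v) ∈ s → f (Finsupp.single (l, v) 1) ∈ M) {n : PathModule R V S}
    (hn : n ∈ Finsupp.supported R R s) : f n ∈ M := by
  rw [Finsupp.supported_eq_span_single] at hn
  induction hn using Submodule.span_induction with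
  | mem x hx =>
    obtain ⟨p, hp, rfl⟩ := hx
    exact h _ _ hp
  | zero => rw [map_zero]; exact M.zero_mem
  | add x y _ _ hx hy => rw [map_add]; exact M.add_mem hx hy
  | smul r x _ hx => rw [map_smul]; exact M.smul_mem r hx

/-- Elements supported on normal paths that end in `v`. -/
def NormalSupported (v : V) (n : PathModule R V S) : Prop :=
  n ∈ Finsupp.supported R R {p : List (Letter S) × V | D.Normal p.1 p.2 ∧ p.2 = v}

lemma NormalSupported.of_mem {v : V} {n : PathModule R V S} (h : D.NormalSupported v n)
    {p : List (Letter S) × V} (hp : n p ≠ 0) : D.Normal p.1 p.2 ∧ p.2 = v :=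
  h (Finset.mem_coe.2 (Finsupp.mem_support_iff.2 hp))

lemma NormalSupported.rep (x : FreeRRing R E) {v : V} {n : PathModule R V S}
    (h : D.NormalSupported v n) : D.NormalSupported v (D.rep R x n) := by
  classical
  induction x using FreeRRing.induction generalizing n with
  | zero => rw [rep_zero]; exact Submodule.zero_mem _
  | gen g =>
    have hp (l : List (Letter S)) : D.path R l v ∈ Finsupp.supported R R
        {p : List (Letter S) × V | D.Normal p.1 p.2 ∧ p.2 = v} :=
      D.path_mem_supported fun h => ⟨h, rfl⟩
    rw [rep_gen]
    refine linearMap_mem_of_supported ?_ h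
    rintro l v ⟨-, rfl⟩
    cases g with
    | vertex u =>
      rw [genMap, vertexMap_single, one_smul]
      split_ifs
      · exact hp l
      · exact Submodule.zero_mem _
    | edge α i =>
      rw [genMap, letterMap_single, one_smul]
      exact D.act_mem _ fun l' _ => hp l'
    | ghost α i =>
      rw [genMap, letterMap_single, one_smul]
      exact D.act_mem _ fun l' _ => hp l'
  | mul x y hx hy => rw [rep_mul]; exact hx (hy h)
  | add x y hx hy => rw [rep_add]; exact Submodule.add_mem _ (hx h) (hy h)
  | smul r x hx => rw [rep_smul]; exact Submodule.smul_mem _ r (hx h)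

variable (R) in
/-- The action of a list of letters. -/
noncomputable def listMap : List (Letter S) → PathModule R V S →ₗ[R] PathModule R V S
  | [] => LinearMap.id
  | x :: l => D.letterMap R x ∘ₗ listMap l

lemma listMap_append (l k : List (Letter S)) (n : PathModule R V S) :
    D.listMap R (l ++ k) n = D.listMap R l (D.listMap R k n) := by
  induction l with
  | nil => rfl
  | cons x l ih => simp only [List.cons_append, listMap, LinearMap.comp_apply, ih]

lemma rep_word (l : List (Letter S)) (v : V) (n : PathModule R V S) :
    D.rep R (word R l v) n = D.listMap R l (D.vertexMap R v n) := by
  induction l with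
  | nil => exact D.rep_vtx v n
  | cons x l ih => rw [word, rep_mul, ih, rep_letterElem]; rfl

lemma listMap_single {l k : List (Letter S)} {v : V} (h : D.Normal (l ++ k) v) :
    D.listMap R l (Finsupp.single (k, v) 1) = Finsupp.single (l ++ k, v) 1 := by
  induction l with
  | nil => rfl
  | cons x l ih =>
    rw [listMap, LinearMap.comp_apply, ih (Normal.tail D h), letterMap_single, one_smul,
      D.act_of_not_forbidden (l := l ++ k) h.2.2.1]
    exact D.path_of_normal h

lemma listMap_mem_length (l : List (Letter S)) {m : ℕ} {n : PathModule R V S}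
    (h : n ∈ Finsupp.supported R R {p : List (Letter S) × V | p.1.length ≤ m}) :
    D.listMap R l n ∈
      Finsupp.supported R R {p : List (Letter S) × V | p.1.length ≤ l.length + m} := by
  induction l with
  | nil => simpa [listMap] using h
  | cons x l ih =>
    rw [listMap, LinearMap.comp_apply]
    refine linearMap_mem_of_supported (fun k v hk => ?_) ih
    rw [letterMap_single, one_smul]
    refine D.act_mem x fun l' hl' => D.path_mem_supported fun _ => ?_
    simp only [Set.mem_ofPred_eq, List.length_cons] at hk ⊢
    omega

lemma listMap_apply_of_length_lt (l : List (Letter S)) {k : List (Letter S)} {v : V}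
    {z : List (Letter S) × V} (hz : l.length + k.length < z.1.length) :
    D.listMap R l (Finsupp.single (k, v) 1) z = 0 := by
  by_contra h
  have := D.listMap_mem_length l (m := k.length) (n := Finsupp.single (k, v) (1 : R))
    (Finsupp.single_mem_supported _ _ (le_refl k.length))
  have := this (Finset.mem_coe.2 (Finsupp.mem_support_iff.2 h))
  simp only [Set.mem_ofPred_eq] at this
  omega

lemma listMap_path_apply_of_length_lt (l : List (Letter S)) {k : List (Letter S)} {v : V}
    {z : List (Letter S) × V} (hz : l.length + k.length < z.1.length) :
    D.listMap R l (D.path R k v) z = 0 := by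
  by_cases h : D.Normal k v
  · rw [D.path_of_normal h, D.listMap_apply_of_length_lt l hz]
  · rw [D.path_of_not_normal h, map_zero, Finsupp.zero_apply]

-- Every letter forbidden before `a` is also forbidden before `x'`, so `l'` followed by a normal
-- path `a b k'` is already normal and prepending `l'` triggers no further rewriting.
open Classical in
lemma listMap_path_apply {l l' k k' : List (Letter S)} (hl : l'.length = l.length)
    {x y x' a b : Letter S} {u v : V} (hz : D.Normal (l ++ x :: y :: k) v)
    (hp : D.Normal (l' ++ [x']) u) (hs : a.start E = x'.start E)
    (hf : ∀ z, D.Forbidden z a → D.Forbidden z x') :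
    D.listMap R l' (D.path R (a :: b :: k') v) (l ++ x :: y :: k, v) =
      if l' = l ∧ a = x ∧ b = y ∧ k' = k then 1 else 0 := by
  by_cases h : D.Normal (a :: b :: k') v
  · rw [D.path_of_normal h, D.listMap_single (Normal.append D hp h hs hf), Finsupp.single_apply]
    congr 1
    rw [Prod.mk.injEq, eq_iff_iff]
    constructor
    · rintro ⟨h1, -⟩
      obtain ⟨h2, h3⟩ := List.append_inj h1 hl
      simp only [List.cons.injEq] at h3
      exact ⟨h2, h3⟩
    · rintro ⟨rfl, rfl, rfl, rfl⟩
      exact ⟨rfl, rfl⟩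
  · rw [D.path_of_not_normal h, map_zero, Finsupp.zero_apply, if_neg]
    rintro ⟨rfl, rfl, rfl, rfl⟩
    exact h (Normal.of_append D hz)

-- The word in question is so long that the shortened term of the rewriting rule cannot reach it.
-- What remains is the word itself, if it is normal, or the replacing pairs, each with coefficient
-- `-1`.
open Classical in
lemma listMap_act_apply {l l' k k' : List (Letter S)} (hl : l'.length = l.length)
    (hk : k'.length = k.length) {x y x' y' : Letter S} {u v : V}
    (hz : D.Normal (l ++ x :: y :: k) v) (hp : D.Normal (l' ++ [x']) u)
    (hq : D.Normal (y' :: k') v) :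
    D.listMap R l' (D.act R x' (y' :: k') v) (l ++ x :: y :: k, v) =
      (if l' = l ∧ x' = x ∧ y' = y ∧ k' = k then 1 else 0) -
      if l' = l ∧ k' = k ∧ D.Swap x y x' y' then 1 else 0 := by
  by_cases hf : D.Forbidden x' y'
  swap
  · rw [D.act_of_not_forbidden (by simpa using hf),
      D.listMap_path_apply hl hz hp rfl fun _ => id, if_neg (c := _ ∧ _ ∧ D.Swap x y x' y'), sub_zero]
    exact fun h => hf h.2.2.forbidden
  have h0 : ¬ (l' = l ∧ x' = x ∧ y' = y ∧ k' = k) := by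
    rintro ⟨-, rfl, rfl, -⟩
    exact (Normal.of_append D hz).2.2.1 y' (by simp) hf
  have h1 (c : Prop) [Decidable c] :
      D.listMap R l' (if c then D.path R k' v else 0) (l ++ x :: y :: k, v) = 0 := by
    split_ifs
    · refine D.listMap_path_apply_of_length_lt l' ?_
      simp
      omega
    · rw [map_zero, Finsupp.zero_apply]
  rw [D.act_of_forbidden hq hf, if_neg h0]
  obtain ⟨α, i, j, hα, rfl, rfl⟩ | ⟨α, β, hα, rfl, rfl⟩ := hf.cases
  · rw [reduct, map_sub, map_sum, Finsupp.sub_apply, Finsupp.finsetSum_apply, h1]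
    congr 1
    have h2 : ∀ γ ∈ (E.emitted (E.src α)).erase α,
        D.listMap R l' (D.path R (.edge γ i :: .ghost γ j :: k') v) (l ++ x :: y :: k, v) =
        if l' = l ∧ .edge γ i = x ∧ .ghost γ j = y ∧ k' = k then 1 else 0 := by
      intro γ hγ
      have hs := mem_emitted.1 (Finset.mem_of_mem_erase hγ)
      refine D.listMap_path_apply hl hz hp hs fun z hz' => ?_
      cases z
      · exact hz'
      · exact ⟨hz'.1, hz'.2.1, hz'.2.2.trans hs⟩
    rw [Finset.sum_congr rfl h2]
    · split_ifs with h
      · obtain ⟨rfl, rfl, h⟩ := h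
        cases h with
        | edge_ghost γ i j h =>
          rw [Finset.sum_eq_single γ]
          · simp
          · intro γ' _ hne
            simp [hne]
          · intro hγ
            rw [Finset.mem_erase, mem_emitted, D.src_special] at hγ
            exact absurd ⟨h, rfl⟩ hγ
      · refine Finset.sum_eq_zero fun γ hγ => if_neg ?_
        rintro ⟨rfl, rfl, rfl, rfl⟩
        refine h ⟨rfl, rfl, ?_⟩
        rw [Finset.mem_erase, mem_emitted] at hγ
        have := Swap.edge_ghost (D := D) γ i j (by rw [hγ.2, ← hα]; exact hγ.1)
        rwa [hγ.2, ← hα] at this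
  · rw [reduct, map_sub, map_sum, Finsupp.sub_apply, Finsupp.finsetSum_apply, h1]
    congr 1
    have h2 : ∀ m ∈ Finset.Ico 1 (E.weight α),
        D.listMap R l' (D.path R (.ghost α m :: .edge β m :: k') v) (l ++ x :: y :: k, v) =
        if l' = l ∧ .ghost α m = x ∧ .edge β m = y ∧ k' = k then 1 else 0 := by
      intro m hm
      refine D.listMap_path_apply hl hz hp rfl fun z hz' => ?_
      cases z <;> exact hz'
    rw [Finset.sum_congr rfl h2]
    · split_ifs with h
      · obtain ⟨rfl, rfl, h⟩ := h
        cases h with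
        | ghost_edge α β m hm h =>
          have hw : m < E.weight α := (Normal.of_append D hz).1
          rw [Finset.sum_eq_single m]
          · simp
          · intro m' _ hne
            simp [hne]
          · intro hm'
            rw [Finset.mem_Ico] at hm'
            omega
      · refine Finset.sum_eq_zero fun m hm => if_neg ?_
        rintro ⟨rfl, rfl, rfl, rfl⟩
        rw [Finset.mem_Ico] at hm
        exact h ⟨rfl, rfl, .ghost_edge α β m (by omega) hα⟩

open Classical in
/-- The coefficients of words of maximal length in the product of two normal paths. -/
lemma listMap_single_apply {l k : List (Letter S)} {x y : Letter S} {u v : V}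
    (hz : D.Normal (l ++ x :: y :: k) v) {p q : List (Letter S) × V}
    (hp : D.Normal p.1 p.2) (hpu : p.2 = u) (hq : D.Normal q.1 q.2) (hqv : q.2 = v)
    (hpl : p.1.length ≤ l.length + 1) (hql : q.1.length ≤ k.length + 1) :
    D.listMap R p.1 (Finsupp.single q 1) (l ++ x :: y :: k, v) =
      (if p = (l ++ [x], u) ∧ q = (y :: k, v) then 1 else 0) -
      if ∃ x' y', D.Swap x y x' y' ∧ p = (l ++ [x'], u) ∧ q = (y' :: k, v) then 1 else 0 := by
  obtain ⟨p, u'⟩ := p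
  obtain ⟨q, v'⟩ := q
  simp only at hpu hqv hp hq hpl hql ⊢
  subst hpu hqv
  -- Shorter products cannot reach the word. Otherwise both length bounds are equalities, so `p` has
  -- a last and `q` a first letter.
  by_cases hlt : p.length + q.length < l.length + 1 + (k.length + 1)
  · rw [D.listMap_apply_of_length_lt, if_neg, if_neg, sub_zero]
    · rintro ⟨x', y', -, h1, h2⟩
      simp only [Prod.mk.injEq, and_true] at h1 h2
      subst h1 h2
      simp at hlt
    · rintro ⟨h1, h2⟩
      simp only [Prod.mk.injEq, and_true] at h1 h2
      subst h1 h2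
      simp at hlt
    · simp
      omega
  obtain ⟨y', k', rfl⟩ : ∃ y' k', q = y' :: k' := by
    cases q with
    | nil => simp at hlt; omega
    | cons y' k' => exact ⟨y', k', rfl⟩
  obtain ⟨l', x', rfl⟩ : ∃ l' x', p = l' ++ [x'] := by
    cases p using List.reverseRecOn with
    | nil => simp at hlt hql; omega
    | append_singleton l' x' => exact ⟨l', x', rfl⟩
  simp only [List.length_append, List.length_cons, List.length_nil] at hpl hql hlt
  have h1 : D.listMap R (l' ++ [x']) (Finsupp.single (y' :: k', v') 1) =
      D.listMap R l' (D.act R x' (y' :: k') v') := by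
    rw [listMap_append]
    simp [listMap]
  rw [h1, D.listMap_act_apply (by omega) (by omega) hz hp hq]
  congr 2
  · rw [eq_iff_iff]
    simp only [Prod.mk.injEq, and_true, List.append_singleton_inj, List.cons.injEq]
    tauto
  · rw [eq_iff_iff]
    simp only [Prod.mk.injEq, and_true, List.append_singleton_inj, List.cons.injEq]
    constructor
    · rintro ⟨h1, h2, h3⟩
      exact ⟨x', y', h3, ⟨h1, rfl⟩, rfl, h2⟩
    · rintro ⟨a, b, h, ⟨h1, rfl⟩, rfl, h2⟩
      exact ⟨h1, h2, h⟩

end Action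

/-! ### Nonvanishing of products -/

section Product

variable {R : Type w} [Ring R]

/-- Elements supported on normal paths from `u` to `v`. -/
def NormalBetween (u v : V) (n : PathModule R V S) : Prop :=
  ∀ p, n p ≠ 0 → D.Normal p.1 p.2 ∧ pathStart E p.1 p.2 = u ∧ p.2 = v

open Classical in
lemma vertexMap_apply (u : V) (n : PathModule R V S) (p : List (Letter S) × V) :
    D.vertexMap R u n p = if D.Normal p.1 p.2 ∧ pathStart E p.1 p.2 = u then n p else 0 := by
  induction n using Finsupp.induction_linear with
  | zero => simp
  | add f g hf hg =>
    rw [map_add, Finsupp.add_apply, hf, hg, Finsupp.add_apply]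
    split_ifs <;> simp
  | single q r =>
    obtain ⟨l, v⟩ := q
    rw [vertexMap_single]
    by_cases h1 : pathStart E l v = u
    · by_cases h2 : D.Normal l v
      · rw [if_pos h1, D.path_of_normal h2, Finsupp.smul_single, smul_eq_mul, mul_one]
        by_cases hp : (l, v) = p
        · subst hp
          rw [if_pos ⟨h2, h1⟩]
        · simp [hp]
      · rw [D.path_of_not_normal h2]
        by_cases hp : (l, v) = p
        · subst hp
          simp [h2]
        · simp [hp]
    · rw [if_neg h1]
      by_cases hp : (l, v) = p
      · subst hp
        simp [h1]
      · simp [hp]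

lemma NormalSupported.vertexMap {v : V} {n : PathModule R V S} (h : D.NormalSupported v n) (u : V) :
    D.NormalBetween u v (D.vertexMap R u n) := by
  classical
  intro p hp
  rw [vertexMap_apply] at hp
  have h1 := (ite_ne_right_iff.1 hp)
  exact ⟨h1.1.1, h1.1.2, (h.of_mem D h1.2).2⟩

lemma NormalBetween.vertexMap_eq {u v : V} {n : PathModule R V S} (h : D.NormalBetween u v n) :
    D.vertexMap R u n = n := by
  classical
  ext p
  rw [vertexMap_apply]
  by_cases hp : n p = 0
  · simp [hp]
  · rw [if_pos ⟨(h p hp).1, (h p hp).2.1⟩]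

lemma rep_embed {u v : V} {m n : PathModule R V S} (hm : D.NormalSupported u m)
    (hn : D.NormalBetween u v n) : D.rep R (D.embed R m) n =
      ∑ p ∈ m.support, ∑ q ∈ n.support, (m p * n q) • D.listMap R p.1 (Finsupp.single q 1) := by
  classical
  have h1 : D.embed R m = ∑ p ∈ m.support, m p • word R p.1 p.2 := by
    rw [embed, Finsupp.linearCombination_apply, Finsupp.sum]
    refine Finset.sum_congr rfl fun p hp => ?_
    rw [if_pos (hm.of_mem D (Finsupp.mem_support_iff.1 hp)).1]
  have h2 : n = ∑ q ∈ n.support, n q • Finsupp.single q (1 : R) := by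
    conv_lhs => rw [← Finsupp.sum_single n, Finsupp.sum]
    simp
  rw [h1, rep_sum]
  refine Finset.sum_congr rfl fun p hp => ?_
  rw [rep_smul, rep_word, (hm.of_mem D (Finsupp.mem_support_iff.1 hp)).2, hn.vertexMap_eq]
  conv_lhs => rw [h2]
  rw [map_sum, Finset.smul_sum]
  simp only [map_smul, smul_smul]

lemma rep_embed_apply {u v : V} {m n : PathModule R V S} (hm : D.NormalSupported u m)
    (hn : D.NormalBetween u v n) (z : List (Letter S) × V) : D.rep R (D.embed R m) n z =
      ∑ p ∈ m.support, ∑ q ∈ n.support, m p * n q * D.listMap R p.1 (Finsupp.single q 1) z := by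
  rw [D.rep_embed hm hn]
  simp [Finsupp.finsetSum_apply]

lemma sum_sum_mul_ite {ι κ : Type*} (m : ι →₀ R) (n : κ →₀ R) (a : ι) (b : κ)
    [∀ p q, Decidable (p = a ∧ q = b)] :
    ∑ p ∈ m.support, ∑ q ∈ n.support, m p * n q * (if p = a ∧ q = b then 1 else 0) =
      m a * n b := by
  rw [Finset.sum_eq_single a, Finset.sum_eq_single b]
  · simp
  · intro q _ hq
    simp [hq]
  · intro hb
    simp [Finsupp.notMem_support_iff.1 hb]
  · intro p _ hp
    simp [hp]
  · intro ha
    simp [Finsupp.notMem_support_iff.1 ha]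

variable [IsDomain R]

/-- A factor supported on trivial paths is a scalar multiple of the trivial path at `u`, so no
rewriting occurs and the coefficients are multiplied in the domain `R`. -/
lemma rep_embed_ne_zero_of_length_zero {u v : V} {m n : PathModule R V S}
    (hm : D.NormalSupported u m) (hn : D.NormalBetween u v n)
    (h : (∀ p, m p ≠ 0 → p.1 = []) ∨ (∀ q, n q ≠ 0 → q.1 = []))
    {p q : List (Letter S) × V} (hp : m p ≠ 0) (hq : n q ≠ 0) :
    D.rep R (D.embed R m) n ≠ 0 := by
  classical
  intro h0
  have hz (z : List (Letter S) × V) := D.rep_embed_apply hm hn z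
  simp only [h0, Finsupp.zero_apply] at hz
  refine mul_ne_zero hp hq ?_
  rw [← sum_sum_mul_ite m n p q]
  rcases h with h | h
  · refine Eq.trans (Finset.sum_congr rfl fun p' hp' => Finset.sum_congr rfl fun q' hq' => ?_)
      (hz q).symm
    rw [Finsupp.mem_support_iff] at hp' hq'
    have hpp : p' = p := Prod.ext ((h _ hp').trans (h _ hp).symm)
      ((hm.of_mem D hp').2.trans (hm.of_mem D hp).2.symm)
    beta_reduce
    rw [h _ hp', listMap, LinearMap.id_apply, Finsupp.single_apply]
    simp [hpp]
  · refine Eq.trans (Finset.sum_congr rfl fun p' hp' => Finset.sum_congr rfl fun q' hq' => ?_)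
      (hz p).symm
    rw [Finsupp.mem_support_iff] at hp' hq'
    have hqq : q' = q := Prod.ext ((h _ hq').trans (h _ hq).symm)
      ((hn _ hq').2.2.trans (hn _ hq).2.2.symm)
    have hqu : q' = ([], p'.2) := by
      have h1 := (hn _ hq').2.1
      rw [h _ hq', pathStart, ← (hm.of_mem D hp').2] at h1
      exact Prod.ext (h _ hq') h1
    have hN : D.Normal (p'.1 ++ []) p'.2 := by
      rw [List.append_nil]
      exact (hm.of_mem D hp').1
    beta_reduce
    rw [hqu, D.listMap_single hN, List.append_nil, Finsupp.single_apply, ← hqu]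
    simp [hqq]

/-- The product of nonzero combinations of normal paths that end, respectively start, in `u` is
nonzero. -/
lemma rep_embed_ne_zero {u v : V} {m n : PathModule R V S} (hm : D.NormalSupported u m)
    (hn : D.NormalBetween u v n) (hm0 : m ≠ 0) (hn0 : n ≠ 0) :
    D.rep R (D.embed R m) n ≠ 0 := by
  classical
  obtain ⟨p, hp, hpmax⟩ := Finset.exists_max_image m.support (fun p => p.1.length)
    (Finsupp.support_nonempty_iff.2 hm0)
  obtain ⟨q, hq, hqmax⟩ := Finset.exists_max_image n.support (fun p => p.1.length)
    (Finsupp.support_nonempty_iff.2 hn0)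
  simp only [Finsupp.mem_support_iff] at hp hq hpmax hqmax
  obtain ⟨hpn, hpu⟩ := hm.of_mem D hp
  obtain ⟨hqn, hqs, hqv⟩ := hn q hq
  obtain ⟨p, u'⟩ := p
  obtain ⟨q, v'⟩ := q
  simp only at hpmax hqmax hpn hpu hqn hqs hqv
  subst hpu hqv
  cases p using List.reverseRecOn with
  | nil =>
    refine D.rep_embed_ne_zero_of_length_zero hm hn (.inl fun p hp => ?_) hp hq
    simpa using hpmax p hp
  | append_singleton l x₀ =>
  cases q with
  | nil =>
    refine D.rep_embed_ne_zero_of_length_zero hm hn (.inr fun p hp => ?_) hp hq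
    simpa using hqmax p hp
  | cons y₀ k =>
  intro h0
  set f : Letter S → R := fun x => m (l ++ [x], u') with hf
  set g : Letter S → R := fun y => n (y :: k, v') with hg
  -- The vanishing coefficient of `l x y k` in the product is `f x * g y` minus the contribution of
  -- the forbidden pair that rewrites to `x y`, if there is one.
  have hcoef (x y : Letter S) (hz : D.Normal (l ++ x :: y :: k) v') :
      ∑ p ∈ m.support, ∑ q ∈ n.support, m p * n q *
        (if ∃ x' y', D.Swap x y x' y' ∧ p = (l ++ [x'], u') ∧ q = (y' :: k, v') then 1 else 0) =
      f x * g y := by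
    have h1 := D.rep_embed_apply hm hn (l ++ x :: y :: k, v')
    rw [h0, Finsupp.zero_apply, Finset.sum_congr rfl fun p hp => Finset.sum_congr rfl fun q hq =>
      congrArg (m p * n q * ·) (D.listMap_single_apply (u := u') hz
        (hm.of_mem D (Finsupp.mem_support_iff.1 hp)).1
        (hm.of_mem D (Finsupp.mem_support_iff.1 hp)).2
        (hn q (Finsupp.mem_support_iff.1 hq)).1 (hn q (Finsupp.mem_support_iff.1 hq)).2.2
        (by simpa using hpmax p (Finsupp.mem_support_iff.1 hp))
        (by simpa using hqmax q (Finsupp.mem_support_iff.1 hq)))] at h1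
    simp only [mul_sub, Finset.sum_sub_distrib] at h1
    rw [sum_sum_mul_ite, eq_comm, sub_eq_zero] at h1
    exact h1.symm
  have hswap (x y x' y' : Letter S) (hs : D.Swap x y x' y')
      (hz : D.Normal (l ++ x :: y :: k) v') : f x' * g y' = f x * g y := by
    rw [← hcoef x y hz, ← sum_sum_mul_ite m n]
    refine Finset.sum_congr rfl fun p _ => Finset.sum_congr rfl fun q _ => ?_
    congr 2
    rw [eq_iff_iff]
    constructor
    · exact fun h => ⟨x', y', hs, h⟩
    · rintro ⟨a, b, h1, h2⟩
      obtain ⟨rfl, rfl⟩ := hs.unique D h1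
      exact h2
  -- A pair that is neither forbidden nor produced by rewriting would leave the nonzero coefficient
  -- `f x * g y` uncancelled.
  have hgen (x y : Letter S) (hx : f x ≠ 0) (hy : g y ≠ 0) (hxy : ¬ D.Forbidden x y) :
      ∃ x' y', D.Swap x y x' y' := by
    by_contra! hs
    obtain ⟨h1, -⟩ := hm.of_mem D hx
    obtain ⟨h2, h3, -⟩ := hn _ hy
    have h4 : D.Normal [x] u' := Normal.of_append D h1
    have h5 : D.Normal (x :: y :: k) v' := ⟨h4.1, h4.2.1.trans h3.symm, by simpa using hxy, h2⟩
    have := hcoef x y (Normal.append D h1 h5 rfl fun _ => id)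
    simp only [hs, false_and, exists_false, if_false, mul_zero, Finset.sum_const_zero] at this
    exact mul_ne_zero hx hy this.symm
  have hx₀ : x₀.finish E = u' := (Normal.of_append D hpn : D.Normal [x₀] u').2.1
  have hy₀ : y₀.start E = u' := hqs
  cases x₀ with
  | edge α i =>
    cases y₀ with
    | edge β j =>
      obtain ⟨_, _, h⟩ := hgen _ _ hp hq fun h => h
      cases h
    | ghost β j =>
      have hi : i < E.weight α := (Normal.of_append D hpn : D.Normal [_] u').1
      have hj : j < E.weight β := hqn.1
      by_cases hαβ : α = β
      · subst hαβ
        have hzero (γ : S) (hγ : α ≠ γ) : g (.ghost γ j) = 0 := by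
          by_contra h
          obtain ⟨_, _, h'⟩ := hgen (.edge α i) (.ghost γ j) hp h fun h => hγ h.1
          cases h'
          exact hγ rfl
        by_cases hα : α = D.special (E.src α)
        -- The second edge of maximal weight is needed here: `γ_i` and `γ_j^*` exist for all indices
        -- valid for `α`, so the forbidden pair `α_i α_j^*` really produces `γ_i γ_j^*`, whose
        -- coefficient product is zero by `hzero`.
        · set γ := D.other (E.src α) with hγ
          have hs : E.src γ = E.src α := D.src_other α
          have hne : γ ≠ α := fun h => D.other_ne α (by rw [← hγ, h, ← hα])
          have hsp : D.special (E.src γ) = α := by rw [hs, ← hα]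
          have hsw := Swap.edge_ghost (D := D) γ i j (by rw [hsp]; exact hne)
          rw [hsp] at hsw
          have hw := D.weight_le_other α
          have hN : D.Normal (.edge γ i :: .ghost γ j :: k) v' :=
            Normal.edge_ghost D hqn hs (by rw [hsp]; exact hne) (hi.trans_le hw) (hj.trans_le hw)
          have := hswap _ _ _ _ hsw (Normal.append D hpn hN hs fun z hz => by
            cases z
            · exact hz
            · exact ⟨hz.1, hz.2.1, hz.2.2.trans hs⟩)
          rw [hzero γ hne.symm, mul_zero] at this
          exact mul_ne_zero hp hq this
        -- Here `α_i α_j^*` is itself a replacing pair, and it is compared with the special pair it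
        -- comes from.
        · have := hswap _ _ _ _ (.edge_ghost α i j hα)
            (Normal.append D hpn (Normal.edge_ghost D hqn rfl hα hi hj) rfl fun _ => id)
          rw [hzero _ hα, mul_zero] at this
          exact mul_ne_zero hp hq this.symm
      · obtain ⟨_, _, h⟩ := hgen _ _ hp hq fun h => hαβ h.1
        cases h
        exact hαβ rfl
  | ghost α i =>
    cases y₀ with
    | ghost β j =>
      obtain ⟨_, _, h⟩ := hgen _ _ hp hq fun h => h
      cases h
    | edge β j =>
      have hi : i < E.weight α := (Normal.of_append D hpn : D.Normal [_] u').1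
      have hj : j < E.weight β := hqn.1
      have hs : E.src α = E.src β := hx₀.trans hy₀.symm
      have hzero (t : ℕ) (ht : i ≠ t) : g (.edge β t) = 0 := by
        by_contra h
        obtain ⟨_, _, h'⟩ := hgen (.ghost α i) (.edge β t) hp h
          fun h => ht (h.1.trans h.2.1.symm)
        cases h'
        exact ht rfl
      by_cases hij : i = j
      · subst hij
        by_cases hi0 : i = 0
        · subst hi0
          -- Index 1 takes the role of the second edge: since both weights are at least two, `α_0^*
          -- β_0` produces the valid pair `α_1^* β_1`.
          have h1 := D.two_le_weight α
          have h2 := D.two_le_weight β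
          have := hswap _ _ _ _ (.ghost_edge α β 1 one_ne_zero hs) (Normal.append D hpn
            (Normal.ghost_edge D hqn hs one_ne_zero (by omega) (by omega)) rfl fun z hz => by
              cases z <;> exact hz)
          rw [hzero 1 (by omega), mul_zero] at this
          exact mul_ne_zero hp hq this
        · have := hswap _ _ _ _ (.ghost_edge α β i hi0 hs) (Normal.append D hpn
            (Normal.ghost_edge D hqn hs hi0 hi hj) rfl fun _ => id)
          rw [hzero 0 hi0, mul_zero] at this
          exact mul_ne_zero hp hq this.symm
      · exact hq (hzero j hij)

/-- As `n` starts in `u`, it is unchanged by `u`; so `c` may be replaced by `c u`, which is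
congruent to a combination of normal paths ending in `u`. -/
lemma rep_ne_zero {u v : V} {c : FreeRRing R E} {n : PathModule R V S}
    (hc : D.rep R c (Finsupp.single ([], u) 1) ≠ 0) (hn : D.NormalBetween u v n) (hn0 : n ≠ 0) :
    D.rep R c n ≠ 0 := by
  have hu : D.NormalSupported u (Finsupp.single ([], u) (1 : R)) :=
    Finsupp.single_mem_supported _ _ ⟨trivial, rfl⟩
  have := D.rep_embed_ne_zero (hu.rep D c) hn hc hn0
  rwa [← D.rep_congr (D.toLPA_mul_vtx c u), rep_mul, rep_vtx, hn.vertexMap_eq] at this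

lemma rep_mul_letterElem_ne_zero (x : Letter S) (hx : x.Valid E) {c : FreeRRing R E}
    (hc : D.rep R c (Finsupp.single ([], x.start E) 1) ≠ 0) :
    D.rep R (c * letterElem R x) (Finsupp.single ([], x.finish E) 1) ≠ 0 := by
  have hN : D.Normal [x] (x.finish E) := ⟨hx, rfl, by simp, trivial⟩
  rw [rep_mul, rep_letterElem, letterMap_single, one_smul, D.act_of_not_forbidden (by simp),
    D.path_of_normal hN]
  refine D.rep_ne_zero hc (v := x.finish E) (fun p hp => ?_) (by simp)
  obtain rfl : ([x], x.finish E) = p := by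
    by_contra h
    exact hp (Finsupp.single_eq_of_ne' h)
  exact ⟨hN, rfl, rfl⟩

/-- The generalised path is followed letter by letter, each letter being a nonzero normal path. Its
word need not be normal, since the nonvanishing of products is applied anew at each letter. -/
lemma exists_rep_mul_ne_zero {u v : V} (h : E.GenReach u v) (c : FreeRRing R E)
    (hc : D.rep R c (Finsupp.single ([], u) 1) ≠ 0) :
    ∃ x, D.rep R (c * x) (Finsupp.single ([], v) 1) ≠ 0 := by
  classical
  induction h with
  | trivial =>
    refine ⟨vtx R E u, ?_⟩
    rw [rep_mul, rep_vtx, vertexMap_single, if_pos (by rfl), one_smul,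
      D.path_of_normal (by trivial)]
    exact hc
  | edge α i _ ih =>
    obtain ⟨x, hx⟩ := ih
    refine ⟨x * letterElem R (.edge α i), ?_⟩
    rw [← mul_assoc]
    exact D.rep_mul_letterElem_ne_zero (.edge α i) i.2 hx
  | ghost α i _ ih =>
    obtain ⟨x, hx⟩ := ih
    refine ⟨x * letterElem R (.ghost α i), ?_⟩
    rw [← mul_assoc]
    exact D.rep_mul_letterElem_ne_zero (.ghost α i) i.2 hx

end Product

end SpecialEdges

/-! ### Choice of special edges and primeness -/

lemma IsLVGraph.nonempty_specialEdges (hE : E.IsLVGraph) : Nonempty E.SpecialEdges := by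
  have h (v : V) : ∃ p : S × S, ¬ E.IsSink v → (E.src p.1 = v ∧ E.weight p.1 = E.vertexWeight v) ∧
      (E.src p.2 = v ∧ E.weight p.2 = E.vertexWeight v) ∧ p.2 ≠ p.1 := by
    by_cases hv : E.IsSink v
    · obtain ⟨α⟩ := hE.nonempty_edges
      exact ⟨(α, α), fun h => absurd hv h⟩
    · have h1 := hE.two_le_max v hv
      have h2 : (1 : ℕ∞) < 2 := by norm_num
      obtain ⟨a, b, ha, hb, hab⟩ := Set.one_lt_encard_iff.1 (h2.trans_le h1)
      exact ⟨(a, b), fun _ => ⟨ha, hb, hab.symm⟩⟩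
  choose p hp using h
  have hs (α : S) := hp (E.src α) fun h => h α rfl
  exact ⟨{
    special := fun v => (p v).1
    other := fun v => (p v).2
    src_special := fun α => (hs α).1.1
    weight_le_special := fun α => (SpecialEdges.weight_le_vertexWeight α).trans_eq (hs α).1.2.symm
    src_other := fun α => (hs α).2.1.1
    weight_le_other := fun α => (SpecialEdges.weight_le_vertexWeight α).trans_eq (hs α).2.1.2.symm
    other_ne := fun α => (hs α).2.2
    two_le_weight := hE.two_le_weight }⟩

end WeightedGraph

theorem mainTheorem9 {V : Type u} {S : Type v} [Countable V] [Countable S]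
    (E : WeightedGraph V S) (hE : E.IsLVGraph) (R : Type w) [Ring R] [IsDomain R] :
    IsPrimeRing (WeightedGraph.LeavittPathAlgebra R E) := by
  classical
  obtain ⟨D⟩ := hE.nonempty_specialEdges
  obtain ⟨⟨v₀⟩, hconn⟩ := hE.connected
  constructor
  · refine ⟨E.toLPA R (WeightedGraph.vtx R E v₀), 0, fun h => ?_⟩
    rw [← map_zero (E.toLPA R)] at h
    have := D.rep_congr h (Finsupp.single ([], v₀) 1)
    rw [D.rep_vtx, D.rep_zero, D.vertexMap_single, if_pos (by rfl), one_smul,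
      D.path_of_normal (by trivial)] at this
    simp at this
  · intro a b hab
    by_contra! hne
    obtain ⟨a, rfl⟩ := WeightedGraph.toLPA_surjective a
    obtain ⟨b, rfl⟩ := WeightedGraph.toLPA_surjective b
    obtain ⟨v, hv⟩ := D.exists_rep_ne_zero hne.1
    obtain ⟨w, hw⟩ := D.exists_rep_ne_zero hne.2
    have hN : D.NormalSupported w (D.rep R b (Finsupp.single ([], w) 1)) :=
      WeightedGraph.SpecialEdges.NormalSupported.rep D b
        (Finsupp.single_mem_supported _ _ ⟨trivial, rfl⟩)
    obtain ⟨q, hq⟩ := Finsupp.ne_iff.1 hw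
    rw [Finsupp.zero_apply] at hq
    -- Cutting the image under `b` down to the paths starting in `u` keeps the coefficient at `q`,
    -- hence stays nonzero.
    set u := WeightedGraph.pathStart E q.1 q.2 with hu
    obtain ⟨x, hx⟩ := D.exists_rep_mul_ne_zero (hconn v u) a hv
    have hu0 : D.vertexMap R u (D.rep R b (Finsupp.single ([], w) 1)) ≠ 0 := by
      refine Finsupp.ne_iff.2 ⟨q, ?_⟩
      rwa [D.vertexMap_apply, if_pos ⟨(hN.of_mem D hq).1, rfl⟩]
    refine D.rep_ne_zero hx (hN.vertexMap D u) hu0 ?_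
    rw [← D.rep_vtx, ← D.rep_mul, ← D.rep_mul]
    have h0 : E.toLPA R (a * x * WeightedGraph.vtx R E u * b) = E.toLPA R 0 := by
      -- The middle factor joins `v` to `u` and then projects to `u`.
      have := hab (E.toLPA R (x * WeightedGraph.vtx R E u))
      rw [← map_mul, ← map_mul] at this
      rw [map_zero, ← this]
      simp only [mul_assoc]
    rw [D.rep_congr h0, D.rep_zero]
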